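/- **Setting (units $8\pi G=c=1$, no cosmological constant).** Let $k\in\{0,1,-1\}$, let $I,J\subset\mathbb R$ be nonempty open intervals, let $\varphi>0,\omega_1,\omega_2$ be smooth on $I$ and $Q$ smooth on $J$, and put $\omega=\omega_1(\tau)+\omega_2(\tau)Q(r)$, $C=[1+\frac k4(x^2+y^2)]^{-1}$. A *T-model* is a metric $$ds^2=-d\tau^2+\omega^2dr^2+\varphi(\tau)\,C^2(dx^2+dy^2)\qquad(\tau\in I,\ r\in J,\ \omega\neq0,\ 1+\tfrac k4(x^2+y^2)>0)$$ that solves the Einstein equations $G=(\rho+p)\,u\otimes u+p\,g$ with flow $u=\partial_\tau$ and such that $\omega_1\dot\omega_2-\dot\omega_1\omega_2\ne0$, $\dot\varphi\neq0$, $Q'\neq0$, $\dot p\neq0$ everywhere. Put $\pi=p/\rho$ and $\chi=u(p)/u(\rho)=\dot p/\dot\rho$; these are considered at the *regular* points, where $\rho\neq0\neq\dot\rho$. The *ideal sonic condition* is $d\chi\wedge d\pi=0$ at all regular points together with $\chi\neq\pi$ as functions (they do not coincide on any nonempty open set). Put $$\mathcal A=-\frac{\varphi}{\dot\varphi\,\dot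 p},\quad q=\frac34\frac{\dot\varphi^2}{\varphi^2}-\frac k\varphi,\quad \mathcal B=\mathcal A(p+q),\quad \mathcal C=\mathcal A\,p\,q .$$ **Theorem.** 1. A T-model satisfies the ideal sonic condition if and only if one of the following holds: (i) $k=0$ and $\mathcal Ap^2=c_1$, $\mathcal Bp=c_2$, $\mathcal C=c_3$ are constants with $c_2=c_1+c_3=\frac12$; (ii) $k\ne0$ and $\dot\varphi^2=c_0^2\varphi$ for a constant $c_0$. 2. In case (ii) the pressure is negative (at any, equivalently every, point) if and only if $c_0^2+4k>0$; this is automatic for $k=1$. 3. In case (i) there is a constant $\tilde\gamma\notin\{0,1\}$ with $c_1=\frac{\tilde\gamma-1}{2\tilde\gamma}$, $c_3=\frac1{2\tilde\gamma}$, and at every regular point $$\chi=\frac{2\tilde\gamma\,\pi^2}{(\pi+1)(\pi+\tilde\gamma-1)} .$$ Moreover there are constants $\tau_0$ and $l>0$ such that, after removing at most one value of $r$ from $J$, on each open interval $J'$ of remaining values of $r$ a change of coordinates $(\tau,r,x,y)\mapsto(\tau-\tau_0,R(r),l x,l y)$, with $R$ smooth and $R'\neq0$, is an isometry of the model onto the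 metric $$ds^2=-d\tau^2+\varphi(\tau)\big([\alpha(\tau)+Q(r)]^2dr^2+dx^2+dy^2\big),\qquad \varphi=|\tau|^{\frac4{3\tilde\gamma}},\quad \alpha=\begin{cases}|\tau|^{1-2/\tilde\gamma}&\tilde\gamma\neq2\\ \ln|\tau|&\tilde\gamma=2\end{cases}\tag{$*$}$$ on $\{\tau\in I_0,\ r\in R(J'),\ \alpha+Q\neq0\}$, where $I_0=I-\tau_0$ lies in $\tau>0$ or in $\tau<0$, and $Q$ in $(*)$ is a smooth function on $R(J')$ with $Q'\neq0$. 4. Conversely, for every $\tilde\gamma\notin\{0,1\}$, every open interval of $\tau$ inside $\tau>0$ or $\tau<0$, every open interval of $r$ and every smooth $Q$ with $Q'\ne0$ on it, the metric $(*)$ is a T-model (with $k=0$, $\omega_1=\sqrt\varphi\,\alpha$, $\omega_2=\sqrt\varphi$) of case (i) with $c_1=\frac{\tilde\gamma-1}{2\tilde\gamma}$, $c_2=\frac12$, $c_3=\frac1{2\tilde\gamma}$, and its indicatrix at the regular points is the one in 3. Let $\delta=\tilde\alpha/(\alpha+Q)$ with $\tilde\alpha=(\tilde\gamma-2)\alpha$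 if $\tilde\gamma\ne2$ and $\tilde\alpha=2$ if $\tilde\gamma=2$. At each point of $(*)$ the energy conditions $\rho>0$, $0\le\pi<1$ hold if and only if $\tilde\gamma>1$ and $\delta>\tilde\gamma-2$. Every point where they hold is regular, and there the compressibility conditions $$0<\chi<1,\qquad (1+\pi)(\chi-\pi)\chi'(\pi)+2\chi(1-\chi)>0$$ also hold. -/

import Mathlib

open Set
open scoped ContDiff

noncomputable section

/-! ### Tensor calculus in a coordinate chart of a four-dimensional spacetime -/

/-- A point of the chart, with coordinates `(τ, r, x, y)` numbered `0, 1, 2, 3`. -/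
abbrev Pt := Fin 4 → ℝ

/-- The coordinate partial derivative `∂ᵢ f` at `X`. -/
def pd (i : Fin 4) (f : Pt → ℝ) (X : Pt) : ℝ :=
  deriv (fun s => f (Function.update X i s)) (X i)

/-- A metric tensor field, given by its components `g_ab`. -/
abbrev MetricField := Pt → Matrix (Fin 4) (Fin 4) ℝ

/-- The Christoffel symbol `Γ^a_bc`. -/
def christoffel (g : MetricField) (a b c : Fin 4) (X : Pt) : ℝ :=
  (1 / 2) * ∑ d, (g X)⁻¹ a d *
    (pd b (fun Z => g Z d c) X + pd c (fun Z => g Z d b) X - pd d (fun Z => g Z b c) X)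

/-- The Ricci tensor `R_bc` (positive on round spheres). -/
def ricci (g : MetricField) (b c : Fin 4) (X : Pt) : ℝ :=
  ∑ a, (pd a (christoffel g a b c) X - pd c (christoffel g a b a) X
    + ∑ d, (christoffel g a a d X * christoffel g d b c X
      - christoffel g a c d X * christoffel g d b a X))

/-- The scalar curvature. -/
def scalarCurv (g : MetricField) (X : Pt) : ℝ :=
  ∑ b, ∑ c, (g X)⁻¹ b c * ricci g b c X

/-- The Einstein tensor `G_ab`. -/
def einstein (g : MetricField) (a b : Fin 4) (X : Pt) : ℝ :=
  ricci g a b X - (1 / 2) * scalarCurv g X * g X a b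

/-- The pullback `Φ^* g` of a metric. -/
def pullback (Φ : Pt → Pt) (g : MetricField) (X : Pt) : Matrix (Fin 4) (Fin 4) ℝ :=
  fun i j => ∑ a, ∑ b, pd i (fun Z => Φ Z a) X * pd j (fun Z => Φ Z b) X * g (Φ X) a b

/-- `df ∧ dh = 0` at `X`. -/
def WedgeZero (f h : Pt → ℝ) (X : Pt) : Prop :=
  ∀ i j, pd i f X * pd j h X - pd j f X * pd i h X = 0

/-- The comoving unit velocity `u = ∂_τ` (contravariant components). -/
def uVec : Fin 4 → ℝ := Pi.single 0 1

/-- The covariant components of the comoving unit velocity. -/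
def uCov (g : MetricField) (X : Pt) (a : Fin 4) : ℝ := ∑ b, g X a b * uVec b

/-- The directional derivative `u(f) = ∂_τ f`. -/
def uDer (f : Pt → ℝ) (X : Pt) : ℝ := ∑ a, uVec a * pd a f X

/-! ### T-models -/

/-- The data of a metric
`-dτ² + (ω₁(τ) + ω₂(τ) Q(r))² dr² + φ(τ) C² (dx² + dy²)`, `C = (1 + k (x² + y²) / 4)⁻¹`,
where `τ` ranges over `I` and `r` over `J`. -/
structure TData where
  k : ℝ
  I : Set ℝ
  J : Set ℝ
  φ : ℝ → ℝ
  ω₁ : ℝ → ℝ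
  ω₂ : ℝ → ℝ
  Q : ℝ → ℝ

namespace TData

variable (T : TData)

def om (τ r : ℝ) : ℝ := T.ω₁ τ + T.ω₂ τ * T.Q r

def conf (x y : ℝ) : ℝ := (1 + T.k / 4 * (x ^ 2 + y ^ 2))⁻¹

/-- The spacetime domain: the part of the chart where the metric is regular. -/
def domain : Set Pt :=
  {X | X 0 ∈ T.I ∧ X 1 ∈ T.J ∧ T.om (X 0) (X 1) ≠ 0 ∧ 0 < 1 + T.k / 4 * (X 2 ^ 2 + X 3 ^ 2)}

def metric : MetricField := fun X =>
  Matrix.diagonal ![-1, T.om (X 0) (X 1) ^ 2,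
    T.φ (X 0) * T.conf (X 2) (X 3) ^ 2, T.φ (X 0) * T.conf (X 2) (X 3) ^ 2]

/-- The energy density measured by the comoving observer, `ρ = G(u, u)` (units `8πG = c = 1`). -/
def rho (X : Pt) : ℝ := ∑ a, ∑ b, einstein T.metric a b X * uVec a * uVec b

/-- The pressure: one third of the trace of the Einstein tensor on the rest space of `u`. -/
def prs (X : Pt) : ℝ :=
  (1 / 3) * ∑ a, ∑ b, ((T.metric X)⁻¹ a b + uVec a * uVec b) * einstein T.metric a b X

/-- The Einstein equations `G = (ρ + p) u ⊗ u + p g` hold at `X`. -/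
def PerfectFluidAt (X : Pt) : Prop :=
  ∀ a b, einstein T.metric a b X =
    (T.rho X + T.prs X) * uCov T.metric X a * uCov T.metric X b + T.prs X * T.metric X a b

/-- T-models in proper time: perfect fluid solutions with flow `u = ∂_τ`, where `ω₁, ω₂` are
independent, under the standing conditions `φ̇ ≠ 0`, `Q' ≠ 0`, `ṗ ≠ 0`. -/
structure IsTModel : Prop where
  k_mem : T.k = 0 ∨ T.k = 1 ∨ T.k = -1
  I_open : IsOpen T.I
  I_conn : IsConnected T.I
  J_open : IsOpen T.J
  J_conn : IsConnected T.J
  φ_smooth : ContDiffOn ℝ ∞ T.φ T.I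
  ω₁_smooth : ContDiffOn ℝ ∞ T.ω₁ T.I
  ω₂_smooth : ContDiffOn ℝ ∞ T.ω₂ T.I
  Q_smooth : ContDiffOn ℝ ∞ T.Q T.J
  φ_pos : ∀ τ ∈ T.I, 0 < T.φ τ
  wronskian : ∀ τ ∈ T.I, T.ω₁ τ * deriv T.ω₂ τ - deriv T.ω₁ τ * T.ω₂ τ ≠ 0
  perfect_fluid : ∀ X ∈ T.domain, T.PerfectFluidAt X
  φ_deriv : ∀ τ ∈ T.I, deriv T.φ τ ≠ 0
  Q_deriv : ∀ r ∈ T.J, deriv T.Q r ≠ 0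
  prs_deriv : ∀ X ∈ T.domain, uDer T.prs X ≠ 0

/-! ### The ideal sonic condition -/

/-- `π = p / ρ`. -/
def ratio (X : Pt) : ℝ := T.prs X / T.rho X

/-- The indicatrix `χ = u(p) / u(ρ)`. -/
def chi (X : Pt) : ℝ := uDer T.prs X / uDer T.rho X

/-- The points at which both `π` and `χ` are defined. -/
def regular : Set Pt := {X ∈ T.domain | T.rho X ≠ 0 ∧ uDer T.rho X ≠ 0}

/-- The ideal sonic condition: `dχ ∧ dπ = 0`, and `χ ≠ π` as functions, that is,
`χ` and `π` coincide on no nonempty open set. -/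
def IdealSonic : Prop :=
  (∀ X ∈ T.regular, WedgeZero T.chi T.ratio X) ∧
    T.regular ⊆ closure {X ∈ T.regular | T.chi X ≠ T.ratio X}

/-- `𝒜 = ∓ 1 / (√β ṗ)`, where `β = (φ̇ / φ)²` and the sign `±` is that of `φ̇ / φ`. -/
def coeffA (X : Pt) : ℝ := -(1 / (deriv T.φ (X 0) / T.φ (X 0) * uDer T.prs X))

/-- `q = (3/4) β - k / φ`. -/
def qFun (X : Pt) : ℝ :=
  3 / 4 * (deriv T.φ (X 0) / T.φ (X 0)) ^ 2 - T.k / T.φ (X 0)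

def coeffB (X : Pt) : ℝ := T.coeffA X * (T.prs X + T.qFun X)

def coeffC (X : Pt) : ℝ := T.coeffA X * T.prs X * T.qFun X

/-- `𝒜 p² = c₁`, `ℬ p = c₂` and `𝒞 = c₃` are constant. -/
def SonicConstants (c₁ c₂ c₃ : ℝ) : Prop :=
  ∀ X ∈ T.domain, T.coeffA X * T.prs X ^ 2 = c₁ ∧ T.coeffB X * T.prs X = c₂ ∧ T.coeffC X = c₃

/-- `k = 0` and `c₂ = c₁ + c₃ = 1/2`. -/
def CaseI : Prop :=
  T.k = 0 ∧ ∃ c₁ c₂ c₃, T.SonicConstants c₁ c₂ c₃ ∧ c₂ = c₁ + c₃ ∧ c₁ + c₃ = 1 / 2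

/-- `k ≠ 0` and `φ̇² = c₀² φ`. -/
def CaseII : Prop :=
  T.k ≠ 0 ∧ ∃ c₀ : ℝ, ∀ τ ∈ T.I, deriv T.φ τ ^ 2 = c₀ ^ 2 * T.φ τ

/-- The energy conditions `E^G` at a point. -/
def EnergyG (X : Pt) : Prop := 0 < T.rho X ∧ 0 ≤ T.ratio X ∧ T.ratio X < 1

end TData

/-- The compressibility conditions `H₁^G` for the indicatrix function `χ(π)` at the value `π`. -/
def CompressG (χ : ℝ → ℝ) (π : ℝ) : Prop :=
  0 < χ π ∧ χ π < 1 ∧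
    0 < (1 + π) * (χ π - π) * deriv χ π + 2 * χ π * (1 - χ π)

/-! ### The ideal T-models -/

def idealPhi (γ τ : ℝ) : ℝ := |τ| ^ (4 / (3 * γ))

open Classical in
def idealAlpha (γ τ : ℝ) : ℝ := if γ = 2 then Real.log |τ| else |τ| ^ (1 - 2 / γ)

open Classical in
def idealAlphaTilde (γ τ : ℝ) : ℝ := if γ = 2 then 2 else (γ - 2) * idealAlpha γ τ

/-- The metric `-dτ² + φ ([α + Q]² dr² + dx² + dy²)`, that is, `k = 0`, `ω₁ = √φ α`, `ω₂ = √φ`. -/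
def idealT (γ : ℝ) (I J : Set ℝ) (Q : ℝ → ℝ) : TData where
  k := 0
  I := I
  J := J
  φ := idealPhi γ
  ω₁ := fun τ => √(idealPhi γ τ) * idealAlpha γ τ
  ω₂ := fun τ => √(idealPhi γ τ)
  Q := Q

/-- `δ = α̃ / (α + Q)`. -/
def idealDelta (γ : ℝ) (Q : ℝ → ℝ) (τ r : ℝ) : ℝ :=
  idealAlphaTilde γ τ / (idealAlpha γ τ + Q r)

/-- `χ(π) = 2 γ π² / ((π + 1) (π + γ - 1))`. -/
def idealChi (γ π : ℝ) : ℝ := 2 * γ * π ^ 2 / ((π + 1) * (π + γ - 1))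

/-- Admissible data of an ideal T-model. -/
def IdealAdmissible (γ : ℝ) (I J : Set ℝ) (Q : ℝ → ℝ) : Prop :=
  γ ≠ 0 ∧ γ ≠ 1 ∧ IsOpen I ∧ IsConnected I ∧ IsOpen J ∧ IsConnected J ∧
    (I ⊆ Ioi 0 ∨ I ⊆ Iio 0) ∧ ContDiffOn ℝ ∞ Q J ∧ ∀ r ∈ J, deriv Q r ≠ 0

/-- The change of coordinates `(τ, r, x, y) ↦ (τ - τ₀, R(r), l x, l y)`. -/
def coordChange (τ₀ l : ℝ) (R : ℝ → ℝ) (X : Pt) : Pt :=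
  ![X 0 - τ₀, R (X 1), l * X 2, l * X 3]

end

noncomputable section

/-! ### Smooth functions of one variable -/

/-! The Einstein tensor of such a metric is diagonal. With `b = φ̇/φ`, the density is `ρ = b ω̇/ω +
b²/4 + k/φ`, and the radial pressure depends on `τ` alone. The fluid equations therefore reduce to
equality of the radial and tangential pressures (`Reg.perfectFluidAt_iff`). Hence `p = p(τ)`, and
`ω₁`, `ω₂` solve one linear second-order equation (`IsTModel.omegaEq`). Energy conservation reads `b
ρ̇ = -(ρ + p)(ρ + q)`, which gives `χ = 1/(𝒜 ρ² + ℬ ρ + 𝒞)` with coefficients depending on `τ` only.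

Since `π = p(τ)/ρ`, the equation `dχ ∧ dπ = 0` is a quadratic equation in `ρ` with coefficients
depending on `τ`. At fixed `τ` the density takes infinitely many values, so all three coefficients
vanish; this says that `𝒜 p²`, `ℬ p`, `𝒞` are constants `c₁`, `c₂`, `c₃`
(`IsTModel.exists_sonicConstants`). Conversely, such constants make `χ` a rational function of `π`
which equals `π` only at roots of a nonzero quadratic (`IsTModel.idealSonic`).

The constants force `c₁ q = c₃ p` and `c₂ = c₁ + c₃`. Differentiating the first relation yields a
quadratic relation between `p` and `k/φ` (`IsTModel.sonic_quadratic`). For `k = 0` it reads `c₁ + c₃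
= 1/2`. For `k ≠ 0` it forces `(k/φ)/p` to be constant, and then `φ̇²` is a constant multiple of
`φ`.

For `k = 0` put `γ = 1/(2c₃)`. Then `ḃ = -(3γ/4) b²`, so `φ` is a power of `τ - τ₀`, and the
equation for `ω` becomes an Euler equation with solutions `√φ α` and `√φ`. Thus `ω` is `√φ` times
`(A₁ + A₂Q) α + (B₁ + B₂Q)`. Taking an antiderivative of `A₁ + A₂Q` as radius gives the normal form
(`IsTModel.exists_isometry`). The converse and the physical conditions are explicit computations,
resting on `p = (γ - 1) q` and `ρ = q (1 + δ)`. -/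

theorem ContDiffOn.hasDerivAt_of_isOpen {f : ℝ → ℝ} {s : Set ℝ} (hf : ContDiffOn ℝ ∞ f s)
    (hs : IsOpen s) {t : ℝ} (ht : t ∈ s) : HasDerivAt f (deriv f t) t :=
  ((hf.contDiffAt (hs.mem_nhds ht)).differentiableAt (by simp)).hasDerivAt

theorem ContDiffOn.deriv_infty {f : ℝ → ℝ} {s : Set ℝ} (hf : ContDiffOn ℝ ∞ f s)
    (hs : IsOpen s) : ContDiffOn ℝ ∞ (deriv f) s :=
  ((contDiffOn_infty_iff_deriv_of_isOpen hs).1 hf).2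

/-! ### Coordinate partial derivatives -/

/-- `f` has the partial derivative `f'` in the direction of the `i`-th coordinate at `X`. -/
def HasPd (i : Fin 4) (f : Pt → ℝ) (f' : ℝ) (X : Pt) : Prop :=
  HasDerivAt (fun s => f (Function.update X i s)) f' (X i)

namespace HasPd

variable {i : Fin 4} {f h : Pt → ℝ} {f' h' : ℝ} {X : Pt}

theorem pd_eq (hf : HasPd i f f' X) : pd i f X = f' := HasDerivAt.deriv hf

theorem congr_val (hf : HasPd i f f' X) (e : f' = h') : HasPd i f h' X := e ▸ hf

theorem add (hf : HasPd i f f' X) (hh : HasPd i h h' X) :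
    HasPd i (fun Z => f Z + h Z) (f' + h') X := HasDerivAt.add hf hh

theorem sub (hf : HasPd i f f' X) (hh : HasPd i h h' X) :
    HasPd i (fun Z => f Z - h Z) (f' - h') X := HasDerivAt.sub hf hh

theorem const (c : ℝ) : HasPd i (fun _ => c) 0 X := hasDerivAt_const _ _

theorem mul (hf : HasPd i f f' X) (hh : HasPd i h h' X) :
    HasPd i (fun Z => f Z * h Z) (f' * h X + f X * h') X := by
  simpa [HasPd] using HasDerivAt.fun_mul hf hh

theorem const_mul (c : ℝ) (hf : HasPd i f f' X) : HasPd i (fun Z => c * f Z) (c * f') X :=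
  HasDerivAt.const_mul c hf

theorem pow (n : ℕ) (hf : HasPd i f f' X) :
    HasPd i (fun Z => f Z ^ n) (n * f X ^ (n - 1) * f') X := by
  simpa [HasPd] using HasDerivAt.fun_pow hf n

theorem div (hf : HasPd i f f' X) (hh : HasPd i h h' X) (h0 : h X ≠ 0) :
    HasPd i (fun Z => f Z / h Z) ((f' * h X - f X * h') / h X ^ 2) X := by
  simpa [HasPd] using HasDerivAt.fun_div hf hh (by simpa using h0)

theorem comp {u : ℝ → ℝ} {u' : ℝ} (hu : HasDerivAt u u' (f X)) (hf : HasPd i f f' X) :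
    HasPd i (fun Z => u (f Z)) (u' * f') X :=
  HasDerivAt.comp (X i) (h₂ := u) (by simpa using hu) hf

theorem coord (i j : Fin 4) (X : Pt) : HasPd i (fun Z => Z j) (if i = j then 1 else 0) X := by
  unfold HasPd
  split_ifs with h
  · subst h
    simpa using hasDerivAt_id' (X i)
  · simpa [Function.update_of_ne (Ne.symm h)] using hasDerivAt_const (X i) (X j)

end HasPd

theorem tendsto_update (i : Fin 4) (X : Pt) :
    Filter.Tendsto (fun s => Function.update X i s) (nhds (X i)) (nhds X) := by
  have : Continuous (fun s => Function.update X i s) := by fun_prop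
  simpa using this.tendsto (X i)

/-- A partial derivative depends only on the germ, so formulas valid just on the open domain, such
as the table of Christoffel symbols, may be differentiated there. -/
theorem pd_congr {f h : Pt → ℝ} {X : Pt} (i : Fin 4) (e : f =ᶠ[nhds X] h) :
    pd i f X = pd i h X :=
  Filter.EventuallyEq.deriv_eq ((tendsto_update i X).eventually e)

theorem HasPd.congr {f h : Pt → ℝ} {f' : ℝ} {X : Pt} {i : Fin 4} (hf : HasPd i f f' X)
    (e : h =ᶠ[nhds X] f) : HasPd i h f' X :=
  HasDerivAt.congr_of_eventuallyEq hf ((tendsto_update i X).eventually e)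

theorem pd_zero (i : Fin 4) (X : Pt) : pd i 0 X = 0 := by simp [pd]

theorem pd_neg (i : Fin 4) (f : Pt → ℝ) (X : Pt) : pd i (-f) X = -pd i f X := by simp [pd]

theorem uDer_eq (f : Pt → ℝ) (X : Pt) : uDer f X = pd 0 f X := by
  simp [uDer, uVec, Fin.sum_univ_four]

/-! ### Smooth data: derivatives of `ω` and `φ`, openness of the domain. -/

namespace TData

variable (T : TData)

/-- The data are smooth on open sets and `φ` is positive. -/
structure Reg : Prop where
  I_open : IsOpen T.I
  J_open : IsOpen T.J
  φ_smooth : ContDiffOn ℝ ∞ T.φ T.I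
  ω₁_smooth : ContDiffOn ℝ ∞ T.ω₁ T.I
  ω₂_smooth : ContDiffOn ℝ ∞ T.ω₂ T.I
  Q_smooth : ContDiffOn ℝ ∞ T.Q T.J
  φ_pos : ∀ τ ∈ T.I, 0 < T.φ τ

/-- `∂_τ ω`. -/
def omt (τ r : ℝ) : ℝ := deriv T.ω₁ τ + deriv T.ω₂ τ * T.Q r

/-- `∂_τ² ω`. -/
def omtt (τ r : ℝ) : ℝ := deriv (deriv T.ω₁) τ + deriv (deriv T.ω₂) τ * T.Q r

/-- `∂_r ω`. -/
def omr (τ r : ℝ) : ℝ := T.ω₂ τ * deriv T.Q r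

/-- `∂_r² ω`. -/
def omrr (τ r : ℝ) : ℝ := T.ω₂ τ * deriv (deriv T.Q) r

/-- `∂_r ∂_τ ω`. -/
def omtr (τ r : ℝ) : ℝ := deriv T.ω₂ τ * deriv T.Q r

variable {T}

section
variable (hT : T.Reg) {τ r : ℝ}
include hT

theorem Reg.hasDerivAt_om (hτ : τ ∈ T.I) : HasDerivAt (fun s => T.om s r) (T.omt τ r) τ :=
  (hT.ω₁_smooth.hasDerivAt_of_isOpen hT.I_open hτ).add
    ((hT.ω₂_smooth.hasDerivAt_of_isOpen hT.I_open hτ).mul_const _)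

theorem Reg.hasDerivAt_omt (hτ : τ ∈ T.I) : HasDerivAt (fun s => T.omt s r) (T.omtt τ r) τ :=
  ((hT.ω₁_smooth.deriv_infty hT.I_open).hasDerivAt_of_isOpen hT.I_open hτ).add
    (((hT.ω₂_smooth.deriv_infty hT.I_open).hasDerivAt_of_isOpen hT.I_open hτ).mul_const _)

theorem Reg.hasDerivAt_om_r (hr : r ∈ T.J) : HasDerivAt (fun s => T.om τ s) (T.omr τ r) r :=
  ((hT.Q_smooth.hasDerivAt_of_isOpen hT.J_open hr).const_mul _).const_add _

theorem Reg.hasDerivAt_omt_r (hr : r ∈ T.J) : HasDerivAt (fun s => T.omt τ s) (T.omtr τ r) r :=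
  ((hT.Q_smooth.hasDerivAt_of_isOpen hT.J_open hr).const_mul _).const_add _

theorem Reg.hasDerivAt_omr (hτ : τ ∈ T.I) : HasDerivAt (fun s => T.omr s r) (T.omtr τ r) τ :=
  (hT.ω₂_smooth.hasDerivAt_of_isOpen hT.I_open hτ).mul_const _

theorem Reg.hasDerivAt_omr_r (hr : r ∈ T.J) : HasDerivAt (fun s => T.omr τ s) (T.omrr τ r) r :=
  ((hT.Q_smooth.deriv_infty hT.J_open).hasDerivAt_of_isOpen hT.J_open hr).const_mul _

theorem Reg.hasDerivAt_φ (hτ : τ ∈ T.I) : HasDerivAt T.φ (deriv T.φ τ) τ :=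
  hT.φ_smooth.hasDerivAt_of_isOpen hT.I_open hτ

theorem Reg.hasDerivAt_dφ (hτ : τ ∈ T.I) :
    HasDerivAt (deriv T.φ) (deriv (deriv T.φ) τ) τ :=
  (hT.φ_smooth.deriv_infty hT.I_open).hasDerivAt_of_isOpen hT.I_open hτ

theorem Reg.isOpen_domain : IsOpen T.domain := by
  have hU : IsOpen {X : Pt | X 0 ∈ T.I ∧ X 1 ∈ T.J} :=
    (hT.I_open.preimage (continuous_apply 0)).inter (hT.J_open.preimage (continuous_apply 1))
  have hc : ContinuousOn (fun X : Pt => T.om (X 0) (X 1)) {X : Pt | X 0 ∈ T.I ∧ X 1 ∈ T.J} := by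
    have c0 : ContinuousOn (fun X : Pt => X 0) {X : Pt | X 0 ∈ T.I ∧ X 1 ∈ T.J} :=
      (continuous_apply 0).continuousOn
    have c1 : ContinuousOn (fun X : Pt => X 1) {X : Pt | X 0 ∈ T.I ∧ X 1 ∈ T.J} :=
      (continuous_apply 1).continuousOn
    exact (hT.ω₁_smooth.continuousOn.comp c0 fun X hX => hX.1).add
      ((hT.ω₂_smooth.continuousOn.comp c0 fun X hX => hX.1).mul
        (hT.Q_smooth.continuousOn.comp c1 fun X hX => hX.2))
  have h1 := hc.isOpen_inter_preimage hU (isOpen_compl_singleton (x := (0 : ℝ)))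
  have h2 : IsOpen {X : Pt | 0 < 1 + T.k / 4 * (X 2 ^ 2 + X 3 ^ 2)} :=
    isOpen_lt (by fun_prop) (by fun_prop)
  convert h1.inter h2 using 1
  ext X
  simp [domain, and_assoc]

end

/-! ### Partial derivatives of the components -/

section
variable {X : Pt} (i : Fin 4)

theorem _root_.HasPd.of_time {f : ℝ → ℝ} {f' : ℝ} (h : HasDerivAt f f' (X 0)) :
    HasPd i (fun Z => f (Z 0)) (![f', 0, 0, 0] i) X := by
  refine ((HasPd.coord i 0 X).comp h).congr_val ?_
  fin_cases i <;> simp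

theorem _root_.HasPd.of_time_radius {f : ℝ → ℝ → ℝ} {f₀ f₁ : ℝ}
    (h₀ : HasDerivAt (fun s => f s (X 1)) f₀ (X 0)) (h₁ : HasDerivAt (fun s => f (X 0) s) f₁ (X 1)) :
    HasPd i (fun Z => f (Z 0) (Z 1)) (![f₀, f₁, 0, 0] i) X := by
  fin_cases i
  · simpa [HasPd] using h₀
  · simpa [HasPd] using h₁
  · simpa [HasPd] using hasDerivAt_const _ _
  · simpa [HasPd] using hasDerivAt_const _ _

variable (hT : T.Reg) (hX : X ∈ T.domain)

include hX in
theorem conf_ne_zero : T.conf (X 2) (X 3) ≠ 0 := inv_ne_zero hX.2.2.2.ne'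

include hX in
theorem hasPd_conf : HasPd i (fun Z => T.conf (Z 2) (Z 3))
    (![0, 0, -(T.k * X 2 / 2) * T.conf (X 2) (X 3) ^ 2,
      -(T.k * X 3 / 2) * T.conf (X 2) (X 3) ^ 2] i) X := by
  have h0 := hX.2.2.2.ne'
  have := (HasPd.const (i := i) 1).div ((HasPd.const 1).add
    ((((HasPd.coord i 2 X).pow 2).add ((HasPd.coord i 3 X).pow 2)).const_mul (T.k / 4))) h0
  simp only [one_div] at this
  refine this.congr_val ?_
  fin_cases i <;> simp [conf] <;> field_simp <;> ring

include hT hX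

theorem Reg.hasPd_om : HasPd i (fun Z => T.om (Z 0) (Z 1))
    (![T.omt (X 0) (X 1), T.omr (X 0) (X 1), 0, 0] i) X :=
  .of_time_radius i (hT.hasDerivAt_om hX.1) (hT.hasDerivAt_om_r hX.2.1)

theorem Reg.hasPd_omt : HasPd i (fun Z => T.omt (Z 0) (Z 1))
    (![T.omtt (X 0) (X 1), T.omtr (X 0) (X 1), 0, 0] i) X :=
  .of_time_radius i (hT.hasDerivAt_omt hX.1) (hT.hasDerivAt_omt_r hX.2.1)

theorem Reg.hasPd_omr : HasPd i (fun Z => T.omr (Z 0) (Z 1))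
    (![T.omtr (X 0) (X 1), T.omrr (X 0) (X 1), 0, 0] i) X :=
  .of_time_radius i (hT.hasDerivAt_omr hX.1) (hT.hasDerivAt_omr_r hX.2.1)

theorem Reg.hasPd_φ : HasPd i (fun Z => T.φ (Z 0)) (![deriv T.φ (X 0), 0, 0, 0] i) X :=
  .of_time i (hT.hasDerivAt_φ hX.1)

theorem Reg.hasPd_dφ :
    HasPd i (fun Z => deriv T.φ (Z 0)) (![deriv (deriv T.φ) (X 0), 0, 0, 0] i) X :=
  .of_time i (hT.hasDerivAt_dφ hX.1)

end

variable (T) in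
/-- The derivatives of the diagonal components of the metric. -/
def dMetric (X : Pt) : Fin 4 → Fin 4 → ℝ :=
  ![![0, 2 * T.om (X 0) (X 1) * T.omt (X 0) (X 1),
      deriv T.φ (X 0) * T.conf (X 2) (X 3) ^ 2, deriv T.φ (X 0) * T.conf (X 2) (X 3) ^ 2],
    ![0, 2 * T.om (X 0) (X 1) * T.omr (X 0) (X 1), 0, 0],
    ![0, 0, -(T.k * X 2) * T.φ (X 0) * T.conf (X 2) (X 3) ^ 3,
      -(T.k * X 2) * T.φ (X 0) * T.conf (X 2) (X 3) ^ 3],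
    ![0, 0, -(T.k * X 3) * T.φ (X 0) * T.conf (X 2) (X 3) ^ 3,
      -(T.k * X 3) * T.φ (X 0) * T.conf (X 2) (X 3) ^ 3]]

theorem Reg.pd_metric (hT : T.Reg) {X : Pt} (hX : X ∈ T.domain) (i a b : Fin 4) :
    pd i (fun Z => T.metric Z a b) X = if a = b then T.dMetric X i a else 0 := by
  split_ifs with hab
  · subst hab
    have e1 := (hT.hasPd_om i hX).pow 2
    have e2 := (hT.hasPd_φ i hX).mul ((hasPd_conf i hX).pow 2)
    simp only [metric, Matrix.diagonal_apply_eq]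
    fin_cases a
    · exact (HasPd.const (-1)).pd_eq.trans (by fin_cases i <;> simp [dMetric])
    · exact e1.pd_eq.trans (by fin_cases i <;> simp [dMetric])
    · exact e2.pd_eq.trans (by fin_cases i <;> simp [dMetric] <;> ring)
    · exact e2.pd_eq.trans (by fin_cases i <;> simp [dMetric] <;> ring)
  · simp [pd, metric, Matrix.diagonal_apply_ne _ hab]

/-! ### Christoffel symbols -/

section
variable (T)

/-- The logarithmic derivatives occurring among the Christoffel symbols. -/
def gT (X : Pt) : ℝ := T.omt (X 0) (X 1) / T.om (X 0) (X 1)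
def gR (X : Pt) : ℝ := T.omr (X 0) (X 1) / T.om (X 0) (X 1)
def gP (X : Pt) : ℝ := deriv T.φ (X 0) / T.φ (X 0) / 2
def gX (X : Pt) : ℝ := -(T.k / 2) * (X 2 * T.conf (X 2) (X 3))
def gY (X : Pt) : ℝ := -(T.k / 2) * (X 3 * T.conf (X 2) (X 3))
def gTT (X : Pt) : ℝ := T.om (X 0) (X 1) * T.omt (X 0) (X 1)
def gPP (X : Pt) : ℝ := 1 / 2 * (deriv T.φ (X 0) * T.conf (X 2) (X 3) ^ 2)

/-- The table of the Christoffel symbols. -/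
def gam : Fin 4 → Fin 4 → Fin 4 → Pt → ℝ :=
  ![![![0, 0, 0, 0], ![0, T.gTT, 0, 0], ![0, 0, T.gPP, 0], ![0, 0, 0, T.gPP]],
    ![![0, T.gT, 0, 0], ![T.gT, T.gR, 0, 0], ![0, 0, 0, 0], ![0, 0, 0, 0]],
    ![![0, 0, T.gP, 0], ![0, 0, 0, 0], ![T.gP, 0, T.gX, T.gY], ![0, 0, T.gY, -T.gX]],
    ![![0, 0, 0, T.gP], ![0, 0, 0, 0], ![0, 0, -T.gY, T.gX], ![T.gP, 0, T.gX, T.gY]]]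

end

theorem Reg.metric_inv (hT : T.Reg) {X : Pt} (hX : X ∈ T.domain) :
    (T.metric X)⁻¹ = Matrix.diagonal ![-1, (T.om (X 0) (X 1) ^ 2)⁻¹,
      (T.φ (X 0) * T.conf (X 2) (X 3) ^ 2)⁻¹, (T.φ (X 0) * T.conf (X 2) (X 3) ^ 2)⁻¹] := by
  have h1 := hX.2.2.1
  have h2 := conf_ne_zero hX
  have h3 := (hT.φ_pos _ hX.1).ne'
  refine Matrix.inv_eq_right_inv ?_
  rw [metric, Matrix.diagonal_mul_diagonal, ← Matrix.diagonal_one]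
  congr 1
  funext i
  fin_cases i
  · simp
  · simp [h1]
  all_goals exact mul_inv_cancel₀ (mul_ne_zero h3 (pow_ne_zero 2 h2))

theorem Reg.christoffel_eq (hT : T.Reg) {X : Pt} (hX : X ∈ T.domain) (a b c : Fin 4) :
    christoffel T.metric a b c X = T.gam a b c X := by
  have h1 := hX.2.2.1
  have h2 := conf_ne_zero hX
  have h3 := (hT.φ_pos _ hX.1).ne'
  simp only [christoffel, hT.pd_metric hX, hT.metric_inv hX, Matrix.diagonal_apply, ite_mul,
    zero_mul, Finset.sum_ite_eq, Finset.mem_univ, if_true]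
  fin_cases a <;> fin_cases b <;> fin_cases c <;>
    simp [gam, dMetric, gT, gR, gP, gX, gY, gTT, gPP] <;> field_simp

/-! ### Derivatives of the Christoffel symbols -/

section
variable (hT : T.Reg) {X : Pt} (hX : X ∈ T.domain) (i : Fin 4)

include hX in
theorem pd_gX : pd i T.gX X = ![0, 0,
    -(T.k / 2) * (T.conf (X 2) (X 3) - T.k / 2 * X 2 ^ 2 * T.conf (X 2) (X 3) ^ 2),
    T.k ^ 2 / 4 * X 2 * X 3 * T.conf (X 2) (X 3) ^ 2] i :=
  (((HasPd.coord i 2 X).mul (hasPd_conf i hX)).const_mul (-(T.k / 2))).pd_eq.trans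
    (by fin_cases i <;> simp [-mul_eq_mul_left_iff] <;> ring)

include hX in
theorem pd_gY : pd i T.gY X = ![0, 0, T.k ^ 2 / 4 * X 2 * X 3 * T.conf (X 2) (X 3) ^ 2,
    -(T.k / 2) * (T.conf (X 2) (X 3) - T.k / 2 * X 3 ^ 2 * T.conf (X 2) (X 3) ^ 2)] i :=
  (((HasPd.coord i 3 X).mul (hasPd_conf i hX)).const_mul (-(T.k / 2))).pd_eq.trans
    (by fin_cases i <;> simp [-mul_eq_mul_left_iff] <;> ring)

include hT hX

theorem Reg.pd_gT : pd i T.gT X =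
    ![T.omtt (X 0) (X 1) / T.om (X 0) (X 1) - (T.omt (X 0) (X 1) / T.om (X 0) (X 1)) ^ 2,
      T.omtr (X 0) (X 1) / T.om (X 0) (X 1)
        - T.omt (X 0) (X 1) * T.omr (X 0) (X 1) / T.om (X 0) (X 1) ^ 2, 0, 0] i := by
  have h := hX.2.2.1
  exact ((hT.hasPd_omt i hX).div (hT.hasPd_om i hX) h).pd_eq.trans
    (by fin_cases i <;> simp; all_goals field_simp)

theorem Reg.pd_gR : pd i T.gR X =
    ![T.omtr (X 0) (X 1) / T.om (X 0) (X 1)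
        - T.omt (X 0) (X 1) * T.omr (X 0) (X 1) / T.om (X 0) (X 1) ^ 2,
      T.omrr (X 0) (X 1) / T.om (X 0) (X 1) - (T.omr (X 0) (X 1) / T.om (X 0) (X 1)) ^ 2,
      0, 0] i := by
  have h := hX.2.2.1
  exact ((hT.hasPd_omr i hX).div (hT.hasPd_om i hX) h).pd_eq.trans
    (by fin_cases i <;> simp; all_goals field_simp)

theorem Reg.pd_gP : pd i T.gP X =
    ![(deriv (deriv T.φ) (X 0) / T.φ (X 0) - (deriv T.φ (X 0) / T.φ (X 0)) ^ 2) / 2,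
      0, 0, 0] i := by
  have h := (hT.φ_pos _ hX.1).ne'
  have := ((hT.hasPd_dφ i hX).div (hT.hasPd_φ i hX) h).const_mul (1 / 2)
  have e : T.gP = fun Z => 1 / 2 * (deriv T.φ (Z 0) / T.φ (Z 0)) := by
    funext Z
    simp only [gP]
    ring
  rw [e]
  exact this.pd_eq.trans (by fin_cases i <;> simp; all_goals field_simp)

theorem Reg.pd_gTT : pd i T.gTT X =
    ![T.omt (X 0) (X 1) ^ 2 + T.om (X 0) (X 1) * T.omtt (X 0) (X 1),
      T.omr (X 0) (X 1) * T.omt (X 0) (X 1) + T.om (X 0) (X 1) * T.omtr (X 0) (X 1), 0, 0] i :=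
  ((hT.hasPd_om i hX).mul (hT.hasPd_omt i hX)).pd_eq.trans (by fin_cases i <;> simp <;> ring)

theorem Reg.pd_gPP : pd i T.gPP X =
    ![deriv (deriv T.φ) (X 0) * T.conf (X 2) (X 3) ^ 2 / 2, 0,
      -(T.k * X 2 / 2) * deriv T.φ (X 0) * T.conf (X 2) (X 3) ^ 3,
      -(T.k * X 3 / 2) * deriv T.φ (X 0) * T.conf (X 2) (X 3) ^ 3] i :=
  (((hT.hasPd_dφ i hX).mul ((hasPd_conf i hX).pow 2)).const_mul (1 / 2)).pd_eq.trans
    (by fin_cases i <;> simp <;> ring)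

theorem Reg.pd_christoffel (a b c : Fin 4) :
    pd i (christoffel T.metric a b c) X = pd i (T.gam a b c) X :=
  pd_congr i (Filter.eventually_of_mem (hT.isOpen_domain.mem_nhds hX)
    fun _ hZ => hT.christoffel_eq hZ a b c)

end

/-! ### The Ricci and Einstein tensors -/

variable (T) in
/-- The diagonal components of the Ricci tensor. -/
def ricDiag (X : Pt) : Fin 4 → ℝ :=
  ![-(T.omtt (X 0) (X 1) / T.om (X 0) (X 1) + deriv (deriv T.φ) (X 0) / T.φ (X 0)
      - (deriv T.φ (X 0) / T.φ (X 0)) ^ 2 / 2),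
    T.om (X 0) (X 1) * T.omtt (X 0) (X 1)
      + T.om (X 0) (X 1) * T.omt (X 0) (X 1) * (deriv T.φ (X 0) / T.φ (X 0)),
    T.conf (X 2) (X 3) ^ 2 * (deriv (deriv T.φ) (X 0) / 2
      + T.omt (X 0) (X 1) / T.om (X 0) (X 1) * deriv T.φ (X 0) / 2 + T.k),
    T.conf (X 2) (X 3) ^ 2 * (deriv (deriv T.φ) (X 0) / 2
      + T.omt (X 0) (X 1) / T.om (X 0) (X 1) * deriv T.φ (X 0) / 2 + T.k)]

theorem Reg.ricci_eq (hT : T.Reg) {X : Pt} (hX : X ∈ T.domain) (b c : Fin 4) :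
    ricci T.metric b c X = if b = c then T.ricDiag X b else 0 := by
  have h1 := hX.2.2.1
  have h2 := conf_ne_zero hX
  have h3 := (hT.φ_pos _ hX.1).ne'
  -- Polynomial form of the definition of `C`; through it the `x`, `y` part of the metric
  -- contributes its constant curvature `k`.
  have hC : T.conf (X 2) (X 3) =
      T.conf (X 2) (X 3) ^ 2 * (1 + T.k / 4 * (X 2 ^ 2 + X 3 ^ 2)) := by
    rw [pow_two, mul_assoc, conf, inv_mul_cancel₀ hX.2.2.2.ne', mul_one]
  simp only [ricci, hT.pd_christoffel hX, hT.christoffel_eq hX, Fin.sum_univ_four]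
  fin_cases b <;> fin_cases c <;>
    simp [gam, ricDiag, pd_zero, pd_neg, hT.pd_gT hX, hT.pd_gR hX, hT.pd_gP hX, pd_gX hX, pd_gY hX,
      hT.pd_gTT hX, hT.pd_gPP hX]
  all_goals simp only [gTT, gPP, gT, gR, gP, gX, gY]
  all_goals try (field_simp; ring; done)
  all_goals linear_combination T.k * hC
end TData

/-! ### Density, radial and tangential pressure, and isotropy. -/

namespace TData
section
variable (T : TData)

/-- The logarithmic derivative `b = φ̇ / φ`. -/
def logD (τ : ℝ) : ℝ := deriv T.φ τ / T.φ τ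

/-- The energy density as a function of `τ` and `r`. -/
def rhoF (τ r : ℝ) : ℝ := T.logD τ * (T.omt τ r / T.om τ r) + T.logD τ ^ 2 / 4 + T.k / T.φ τ

/-- The radial pressure as a function of `τ`. -/
def pF (τ : ℝ) : ℝ := -(deriv (deriv T.φ) τ / T.φ τ - T.logD τ ^ 2 / 4 + T.k / T.φ τ)

/-- The tangential pressure as a function of `τ` and `r`. -/
def pTan (τ r : ℝ) : ℝ :=
  -(T.omtt τ r / T.om τ r + deriv (deriv T.φ) τ / T.φ τ / 2 - T.logD τ ^ 2 / 4
    + T.omt τ r / T.om τ r * T.logD τ / 2)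

/-- The diagonal components of the Einstein tensor. -/
def einDiag (X : Pt) : Fin 4 → ℝ :=
  ![T.rhoF (X 0) (X 1), T.om (X 0) (X 1) ^ 2 * T.pF (X 0),
    T.φ (X 0) * T.conf (X 2) (X 3) ^ 2 * T.pTan (X 0) (X 1),
    T.φ (X 0) * T.conf (X 2) (X 3) ^ 2 * T.pTan (X 0) (X 1)]

end

variable {T : TData} (hT : T.Reg) {X : Pt} (hX : X ∈ T.domain)
include hT hX

theorem Reg.scalarCurv_eq : scalarCurv T.metric X =
    2 * (T.omtt (X 0) (X 1) / T.om (X 0) (X 1)) + 2 * (deriv (deriv T.φ) (X 0) / T.φ (X 0))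
      - T.logD (X 0) ^ 2 / 2 + 2 * (T.omt (X 0) (X 1) / T.om (X 0) (X 1)) * T.logD (X 0)
      + 2 * (T.k / T.φ (X 0)) := by
  have h1 := hX.2.2.1
  have h2 := conf_ne_zero hX
  have h3 := (hT.φ_pos _ hX.1).ne'
  simp only [scalarCurv, hT.ricci_eq hX, hT.metric_inv hX, Matrix.diagonal_apply, ite_mul,
    zero_mul, mul_ite, mul_zero, Finset.sum_ite_eq, Finset.mem_univ, if_true]
  simp [Fin.sum_univ_four, ricDiag, logD]
  field_simp
  ring

theorem Reg.einstein_eq (a b : Fin 4) :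
    einstein T.metric a b X = if a = b then T.einDiag X a else 0 := by
  have h1 := hX.2.2.1
  have h2 := conf_ne_zero hX
  have h3 := (hT.φ_pos _ hX.1).ne'
  rw [einstein, hT.ricci_eq hX, hT.scalarCurv_eq hX, metric, Matrix.diagonal_apply]
  split_ifs with h
  · fin_cases a <;> simp [ricDiag, einDiag, logD, rhoF, pF, pTan] <;> field_simp <;> ring
  · simp

theorem Reg.rho_eq : T.rho X = T.rhoF (X 0) (X 1) := by
  simp [rho, hT.einstein_eq hX, uVec, Pi.single_apply, einDiag]

theorem Reg.prs_eq : T.prs X = (T.pF (X 0) + 2 * T.pTan (X 0) (X 1)) / 3 := by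
  have h1 := hX.2.2.1
  have h2 := conf_ne_zero hX
  have h3 := (hT.φ_pos _ hX.1).ne'
  simp only [prs, hT.einstein_eq hX, hT.metric_inv hX]
  simp [uVec, Fin.sum_univ_four, einDiag]
  field_simp
  ring

/-- `ρ` is by definition the time component and `p` the mean `(pF + 2 pTan)/3`, so the only content
of the fluid equations is isotropy. -/
theorem Reg.perfectFluidAt_iff : T.PerfectFluidAt X ↔ T.pTan (X 0) (X 1) = T.pF (X 0) := by
  have h1 := hX.2.2.1
  have h2 := conf_ne_zero hX
  have h3 := (hT.φ_pos _ hX.1).ne'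
  have hu : uCov T.metric X = ![-1, 0, 0, 0] := by
    funext a
    fin_cases a <;> simp [uCov, uVec, metric, Matrix.diagonal_apply, Pi.single_apply]
  constructor
  · intro h
    have := h 1 1
    rw [hT.einstein_eq hX, hT.prs_eq hX, hu] at this
    simp [einDiag, metric] at this
    have := mul_left_cancel₀ (pow_ne_zero 2 h1) (this.trans (mul_comm _ _))
    linarith
  · intro h a b
    rw [hT.einstein_eq hX, hT.prs_eq hX, hT.rho_eq hX, hu, metric, Matrix.diagonal_apply, h]
    split_ifs with hab
    · subst hab
      fin_cases a <;> simp [einDiag, h] <;> ring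
    · fin_cases a <;> fin_cases b <;> simp at hab ⊢

end TData

/-! ### T-models: equations for `ω₁`, `ω₂`, evolution of the density, and the indicatrix. -/

theorem injOn_of_deriv_ne_zero {f : ℝ → ℝ} {s : Set ℝ} (hs : IsPreconnected s)
    (hf : ∀ x ∈ s, DifferentiableAt ℝ f x) (h0 : ∀ x ∈ s, deriv f x ≠ 0) : InjOn f s := by
  have key : ∀ x ∈ s, ∀ y ∈ s, x < y → f x ≠ f y := by
    intro x hx y hy hxy h
    have hsub : Icc x y ⊆ s := hs.ordConnected.out hx hy
    obtain ⟨c, hc, hc0⟩ := exists_deriv_eq_zero hxy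
      (fun z hz => (hf z (hsub hz)).continuousAt.continuousWithinAt) h
    exact h0 c (hsub (Ioo_subset_Icc_self hc)) hc0
  intro x hx y hy h
  rcases lt_trichotomy x y with hxy | hxy | hxy
  · exact absurd h (key x hx y hy hxy)
  · exact hxy
  · exact absurd h.symm (key y hy x hx hxy)

namespace TData

section
variable (T : TData)

/-- `q = (3/4) b² - k / φ` as a function of `τ`. -/
def qF (τ : ℝ) : ℝ := 3 / 4 * T.logD τ ^ 2 - T.k / T.φ τ

/-- `𝒜` as a function of `τ`. -/
def aF (τ : ℝ) : ℝ := -(1 / (T.logD τ * deriv T.pF τ))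

/-- `ℬ` as a function of `τ`. -/
def bF (τ : ℝ) : ℝ := T.aF τ * (T.pF τ + T.qF τ)

/-- `𝒞` as a function of `τ`. -/
def cF (τ : ℝ) : ℝ := T.aF τ * T.pF τ * T.qF τ

/-- The derivative `∂_r ρ`. -/
def rhoR (τ r : ℝ) : ℝ :=
  T.logD τ * ((T.ω₁ τ * deriv T.ω₂ τ - deriv T.ω₁ τ * T.ω₂ τ) * deriv T.Q r) / T.om τ r ^ 2

/-- The equation satisfied by `ω₁` and `ω₂`. -/
def OmegaEq (w : ℝ → ℝ) : Prop :=
  ∀ τ ∈ T.I, deriv (deriv w) τ + deriv w τ * T.logD τ / 2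
    = w τ * (deriv (deriv T.φ) τ / T.φ τ / 2 + T.k / T.φ τ)

end

variable {T : TData}

section
variable (hT : T.Reg) {τ : ℝ} (hτ : τ ∈ T.I)
include hT

theorem Reg.contDiffOn_logD : ContDiffOn ℝ ∞ T.logD T.I :=
  (hT.φ_smooth.deriv_infty hT.I_open).div hT.φ_smooth fun τ hτ => (hT.φ_pos τ hτ).ne'

theorem Reg.contDiffOn_pF : ContDiffOn ℝ ∞ T.pF T.I := by
  have h2 := ((hT.φ_smooth.deriv_infty hT.I_open).deriv_infty hT.I_open).div hT.φ_smooth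
    fun τ hτ => (hT.φ_pos τ hτ).ne'
  have h3 : ContDiffOn ℝ ∞ (fun τ => T.k / T.φ τ) T.I :=
    contDiffOn_const.div hT.φ_smooth fun τ hτ => (hT.φ_pos τ hτ).ne'
  exact ((h2.sub ((hT.contDiffOn_logD.pow 2).div_const 4)).add h3).neg

theorem Reg.contDiffOn_qF : ContDiffOn ℝ ∞ T.qF T.I := by
  have h3 : ContDiffOn ℝ ∞ (fun τ => T.k / T.φ τ) T.I :=
    contDiffOn_const.div hT.φ_smooth fun τ hτ => (hT.φ_pos τ hτ).ne'
  exact (contDiffOn_const.mul (hT.contDiffOn_logD.pow 2)).sub h3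

include hτ

/-- The definition of `pF` is read as a formula for `φ̈`. -/
theorem Reg.hasDerivAt_logD :
    HasDerivAt T.logD (-T.pF τ - 3 / 4 * T.logD τ ^ 2 - T.k / T.φ τ) τ := by
  have h := (hT.φ_pos _ hτ).ne'
  refine ((hT.hasDerivAt_dφ hτ).fun_div (hT.hasDerivAt_φ hτ) h).congr_deriv ?_
  simp only [pF, logD]
  field_simp
  ring

theorem Reg.hasDerivAt_kφ :
    HasDerivAt (fun s => T.k / T.φ s) (-(T.k / T.φ τ * T.logD τ)) τ := by
  have h := (hT.φ_pos _ hτ).ne'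
  refine ((hasDerivAt_const τ T.k).fun_div (hT.hasDerivAt_φ hτ) h).congr_deriv ?_
  simp only [logD]
  field_simp
  ring

theorem Reg.hasDerivAt_qF :
    HasDerivAt T.qF (T.logD τ * (-(3 / 2) * (T.pF τ + T.qF τ) - 2 * (T.k / T.φ τ))) τ := by
  refine ((((hT.hasDerivAt_logD hτ).pow 2).const_mul (3 / 4)).sub
    (hT.hasDerivAt_kφ hτ)).congr_deriv ?_
  simp only [qF]
  push_cast
  ring

theorem Reg.hasDerivAt_pF : HasDerivAt T.pF (deriv T.pF τ) τ :=
  hT.contDiffOn_pF.hasDerivAt_of_isOpen hT.I_open hτ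

end

theorem mk_mem_domain {τ r : ℝ} (hτ : τ ∈ T.I) (hr : r ∈ T.J) (h : T.om τ r ≠ 0) :
    ![τ, r, 0, 0] ∈ T.domain :=
  ⟨hτ, hr, h, by simp⟩

section
variable (hT : T.IsTModel)
include hT

theorem IsTModel.reg : T.Reg :=
  ⟨hT.I_open, hT.J_open, hT.φ_smooth, hT.ω₁_smooth, hT.ω₂_smooth, hT.Q_smooth, hT.φ_pos⟩

theorem IsTModel.injOn_Q : InjOn T.Q T.J :=
  injOn_of_deriv_ne_zero hT.J_conn.isPreconnected
    (fun _ hr => (hT.Q_smooth.hasDerivAt_of_isOpen hT.J_open hr).differentiableAt) hT.Q_deriv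

/-- At fixed `τ`, `ω₁ + ω₂Q` has at most one zero in `r`: `Q` is injective, and the Wronskian
prevents `ω₁` and `ω₂` from vanishing together. -/
theorem IsTModel.infinite_om_ne_zero {τ : ℝ} (hτ : τ ∈ T.I) :
    {r ∈ T.J | T.om τ r ≠ 0}.Infinite := by
  have hJ : T.J.Infinite := by
    obtain ⟨r, hr⟩ := hT.J_conn.nonempty
    exact infinite_of_mem_nhds r (hT.J_open.mem_nhds hr)
  have hs : {r ∈ T.J | T.om τ r = 0}.Subsingleton := by
    rintro r ⟨hr, h1⟩ s ⟨hs, h2⟩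
    refine hT.injOn_Q hr hs ?_
    simp only [om] at h1 h2
    have h3 : T.ω₂ τ * (T.Q r - T.Q s) = 0 := by linear_combination h1 - h2
    rcases mul_eq_zero.1 h3 with h | h
    · have : T.ω₁ τ = 0 := by simpa [h] using h1
      exact absurd (by simp [h, this]) (hT.wronskian τ hτ)
    · linarith
  refine (hJ.sdiff hs.finite).mono ?_
  rintro r ⟨hr, h⟩
  exact ⟨hr, fun h0 => h ⟨hr, h0⟩⟩

theorem IsTModel.exists_mem_domain {τ : ℝ} (hτ : τ ∈ T.I) : ∃ X ∈ T.domain, X 0 = τ := by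
  obtain ⟨r, hr, h⟩ := (hT.infinite_om_ne_zero hτ).nonempty
  exact ⟨_, mk_mem_domain hτ hr h, rfl⟩

theorem IsTModel.logD_ne_zero {τ : ℝ} (hτ : τ ∈ T.I) : T.logD τ ≠ 0 :=
  div_ne_zero (hT.φ_deriv τ hτ) (hT.φ_pos τ hτ).ne'

theorem IsTModel.pTan_eq {X : Pt} (hX : X ∈ T.domain) : T.pTan (X 0) (X 1) = T.pF (X 0) :=
  (hT.reg.perfectFluidAt_iff hX).1 (hT.perfect_fluid X hX)

theorem IsTModel.prs_eq {X : Pt} (hX : X ∈ T.domain) : T.prs X = T.pF (X 0) := by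
  rw [hT.reg.prs_eq hX, hT.pTan_eq hX]
  ring

theorem IsTModel.omtt_eq {X : Pt} (hX : X ∈ T.domain) :
    T.omtt (X 0) (X 1) + T.omt (X 0) (X 1) * T.logD (X 0) / 2 = T.om (X 0) (X 1)
      * (deriv (deriv T.φ) (X 0) / T.φ (X 0) / 2 + T.k / T.φ (X 0)) := by
  have h1 := hX.2.2.1
  have := hT.pTan_eq hX
  simp only [pTan, pF] at this
  have e : T.omtt (X 0) (X 1) / T.om (X 0) (X 1)
      + T.omt (X 0) (X 1) / T.om (X 0) (X 1) * T.logD (X 0) / 2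
      = deriv (deriv T.φ) (X 0) / T.φ (X 0) / 2 + T.k / T.φ (X 0) := by linarith
  rw [← e]
  field_simp

/-- The isotropy condition is affine in `Q(r)`; its validity at two radii with different values of
`Q` separates the two coefficients. -/
theorem IsTModel.omegaEq : T.OmegaEq T.ω₁ ∧ T.OmegaEq T.ω₂ := by
  rw [OmegaEq, OmegaEq, ← forall₂_and]
  intro τ hτ
  obtain ⟨r, ⟨hr, hr0⟩, s, ⟨hs, hs0⟩, hrs⟩ := (hT.infinite_om_ne_zero hτ).nontrivial
  have hQ : T.Q r - T.Q s ≠ 0 := fun h => hrs (hT.injOn_Q hr hs (by linarith))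
  have h1 := hT.omtt_eq (mk_mem_domain hτ hr hr0)
  have h2 := hT.omtt_eq (mk_mem_domain hτ hs hs0)
  simp [om, omt, omtt] at h1 h2
  have e2 : deriv (deriv T.ω₂) τ + deriv T.ω₂ τ * T.logD τ / 2
    = T.ω₂ τ * (deriv (deriv T.φ) τ / T.φ τ / 2 + T.k / T.φ τ) := by
    refine mul_left_cancel₀ hQ ?_
    linear_combination h1 - h2
  exact ⟨by linear_combination h1 - T.Q r * e2, e2⟩

/-! ### Derivatives of the density and the pressure -/

theorem IsTModel.uDer_prs {X : Pt} (hX : X ∈ T.domain) : uDer T.prs X = deriv T.pF (X 0) := by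
  rw [uDer_eq, pd_congr 0 (h := fun Z => T.pF (Z 0))
    (Filter.eventually_of_mem (hT.reg.isOpen_domain.mem_nhds hX) fun _ hZ => hT.prs_eq hZ)]
  simpa using (HasPd.of_time 0 (hT.reg.hasDerivAt_pF hX.1)).pd_eq

theorem IsTModel.deriv_pF_ne_zero {τ : ℝ} (hτ : τ ∈ T.I) : deriv T.pF τ ≠ 0 := by
  obtain ⟨X, hX, rfl⟩ := hT.exists_mem_domain hτ
  rw [← hT.uDer_prs hX]
  exact hT.prs_deriv X hX

theorem IsTModel.hasPd_prs {X : Pt} (hX : X ∈ T.domain) (i : Fin 4) :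
    HasPd i T.prs (![deriv T.pF (X 0), 0, 0, 0] i) X :=
  (HasPd.of_time i (hT.reg.hasDerivAt_pF hX.1)).congr
    (Filter.eventually_of_mem (hT.reg.isOpen_domain.mem_nhds hX) fun _ hZ => hT.prs_eq hZ)

theorem IsTModel.rhoR_ne_zero {τ r : ℝ} (hτ : τ ∈ T.I) (hr : r ∈ T.J) (h : T.om τ r ≠ 0) :
    T.rhoR τ r ≠ 0 :=
  div_ne_zero (mul_ne_zero (hT.logD_ne_zero hτ)
    (mul_ne_zero (hT.wronskian τ hτ) (hT.Q_deriv r hr))) (pow_ne_zero 2 h)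

/-- The time component is energy conservation `ρ̇ = -(ρ + p) θ`, where the expansion `θ = ω̇/ω + b`
equals `(ρ + q)/b`. The radial component is nonzero because of the Wronskian and `Q'`. -/
theorem IsTModel.hasPd_rho {X : Pt} (hX : X ∈ T.domain) (i : Fin 4) :
    HasPd i T.rho (![-((T.rho X + T.pF (X 0)) * (T.rho X + T.qF (X 0)) / T.logD (X 0)),
      T.rhoR (X 0) (X 1), 0, 0] i) X := by
  have h0 := hX.2.2.1
  have hb := hT.logD_ne_zero hX.1
  have e' : T.omtt (X 0) (X 1) / T.om (X 0) (X 1) =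
      -T.pF (X 0) - (deriv (deriv T.φ) (X 0) / T.φ (X 0) / 2 - T.logD (X 0) ^ 2 / 4)
        - T.omt (X 0) (X 1) / T.om (X 0) (X 1) * T.logD (X 0) / 2 := by
    have := hT.pTan_eq hX
    simp only [pTan] at this
    linarith
  have ep : deriv (deriv T.φ) (X 0) / T.φ (X 0) =
      -T.pF (X 0) + T.logD (X 0) ^ 2 / 4 - T.k / T.φ (X 0) := by
    simp only [pF]
    ring
  have h1 := HasPd.of_time i (hT.reg.hasDerivAt_logD hX.1)
  have h2 := (hT.reg.hasPd_omt i hX).div (hT.reg.hasPd_om i hX) h0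
  have h3 := HasPd.of_time i (hT.reg.hasDerivAt_kφ hX.1)
  have h4 := ((h1.mul h2).add ((h1.pow 2).const_mul (1 / 4))).add h3
  refine (h4.congr (Filter.eventually_of_mem (hT.reg.isOpen_domain.mem_nhds hX)
    fun Z hZ => (hT.reg.rho_eq hZ).trans ?_)).congr_val ?_
  · simp only [rhoF]
    ring
  · rw [hT.reg.rho_eq hX]
    fin_cases i
    · simp
      rw [show (T.omtt (X 0) (X 1) * T.om (X 0) (X 1) - T.omt (X 0) (X 1) * T.omt (X 0) (X 1))
        / T.om (X 0) (X 1) ^ 2 = T.omtt (X 0) (X 1) / T.om (X 0) (X 1)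
          - (T.omt (X 0) (X 1) / T.om (X 0) (X 1)) ^ 2 by field_simp, e', ep, rhoF, qF]
      -- With `ω̈` and `φ̈` eliminated, the identity is polynomial in `ω̇/ω`, `k/φ`, `p` and `b`, up
      -- to division by `b`.
      generalize T.omt (X 0) (X 1) / T.om (X 0) (X 1) = h
      generalize T.k / T.φ (X 0) = κ
      field_simp
      ring
    · simp [rhoR, omtr, omt, omr, om]
      field_simp
      ring
    · simp
    · simp

theorem IsTModel.uDer_rho {X : Pt} (hX : X ∈ T.domain) :
    uDer T.rho X = -((T.rho X + T.pF (X 0)) * (T.rho X + T.qF (X 0)) / T.logD (X 0)) := by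
  rw [uDer_eq]
  simpa using (hT.hasPd_rho hX 0).pd_eq

theorem IsTModel.chi_eq {X : Pt} (hX : X ∈ T.domain) :
    T.chi X = 1 / (T.aF (X 0) * T.rho X ^ 2 + T.bF (X 0) * T.rho X + T.cF (X 0)) := by
  have hb := hT.logD_ne_zero hX.1
  have hp := hT.deriv_pF_ne_zero hX.1
  have e : T.aF (X 0) * T.rho X ^ 2 + T.bF (X 0) * T.rho X + T.cF (X 0) =
      T.aF (X 0) * ((T.rho X + T.pF (X 0)) * (T.rho X + T.qF (X 0))) := by
    simp only [bF, cF]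
    ring
  rw [chi, hT.uDer_prs hX, hT.uDer_rho hX, e, aF]
  generalize (T.rho X + T.pF (X 0)) * (T.rho X + T.qF (X 0)) = w
  rcases eq_or_ne w 0 with rfl | hw
  · simp
  · field_simp

theorem IsTModel.denom_ne_zero {X : Pt} (hX : X ∈ T.regular) :
    T.aF (X 0) * T.rho X ^ 2 + T.bF (X 0) * T.rho X + T.cF (X 0) ≠ 0 := by
  obtain ⟨hX, -, h⟩ := hX
  intro h0
  have : T.chi X = 0 := by rw [hT.chi_eq hX, h0, div_zero]
  rw [chi, hT.uDer_prs hX] at this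
  exact div_ne_zero (hT.deriv_pF_ne_zero hX.1) h this

theorem IsTModel.contDiffOn_aF : ContDiffOn ℝ ∞ T.aF T.I :=
  (contDiffOn_const.div
    (hT.reg.contDiffOn_logD.mul (hT.reg.contDiffOn_pF.deriv_infty hT.I_open))
    fun _ hτ => mul_ne_zero (hT.logD_ne_zero hτ) (hT.deriv_pF_ne_zero hτ)).neg

theorem IsTModel.contDiffOn_bF : ContDiffOn ℝ ∞ T.bF T.I :=
  hT.contDiffOn_aF.mul (hT.reg.contDiffOn_pF.add hT.reg.contDiffOn_qF)

theorem IsTModel.contDiffOn_cF : ContDiffOn ℝ ∞ T.cF T.I :=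
  (hT.contDiffOn_aF.mul hT.reg.contDiffOn_pF).mul hT.reg.contDiffOn_qF

/-- `χ` and `π` depend on `τ` and `r` only, so one component of the wedge matters. With `N` the
quadratic in `ρ`, it is a nonzero multiple of `p ∂_τN + ṗ ρ ∂_ρN`. -/
theorem IsTModel.wedgeZero_iff {X : Pt} (hX : X ∈ T.regular) : WedgeZero T.chi T.ratio X ↔
    (T.pF (X 0) * deriv T.aF (X 0) + 2 * T.aF (X 0) * deriv T.pF (X 0)) * T.rho X ^ 2
      + (T.pF (X 0) * deriv T.bF (X 0) + T.bF (X 0) * deriv T.pF (X 0)) * T.rho X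
      + T.pF (X 0) * deriv T.cF (X 0) = 0 := by
  have hN := hT.denom_ne_zero hX
  obtain ⟨hd, hρ, -⟩ := hX
  have hR := hT.rhoR_ne_zero hd.1 hd.2.1 hd.2.2.1
  have hr := hT.hasPd_rho hd
  have ha := fun i => HasPd.of_time i (hT.contDiffOn_aF.hasDerivAt_of_isOpen hT.I_open hd.1)
  have hb := fun i => HasPd.of_time i (hT.contDiffOn_bF.hasDerivAt_of_isOpen hT.I_open hd.1)
  have hc := fun i => HasPd.of_time i (hT.contDiffOn_cF.hasDerivAt_of_isOpen hT.I_open hd.1)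
  have h1 := fun i => (((HasPd.const (i := i) 1).div ((((ha i).mul ((hr i).pow 2)).add
    ((hb i).mul (hr i))).add (hc i)) hN).congr (Filter.eventually_of_mem
      (hT.reg.isOpen_domain.mem_nhds hd) fun Z hZ => hT.chi_eq hZ)).pd_eq
  have h2 := fun i => ((hT.hasPd_prs hd i).div (hr i) hρ).pd_eq
  have h2 : ∀ i, pd i T.ratio X = _ := h2
  have h01 : pd 0 T.chi X * pd 1 T.ratio X - pd 1 T.chi X * pd 0 T.ratio X =
      T.rhoR (X 0) (X 1) / (T.rho X *
        (T.aF (X 0) * T.rho X ^ 2 + T.bF (X 0) * T.rho X + T.cF (X 0))) ^ 2 *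
      ((T.pF (X 0) * deriv T.aF (X 0) + 2 * T.aF (X 0) * deriv T.pF (X 0)) * T.rho X ^ 2
      + (T.pF (X 0) * deriv T.bF (X 0) + T.bF (X 0) * deriv T.pF (X 0)) * T.rho X
      + T.pF (X 0) * deriv T.cF (X 0)) := by
    rw [h1, h1, h2, h2, hT.prs_eq hd]
    simp only [Matrix.cons_val_zero, Matrix.cons_val_one]
    generalize T.aF (X 0) * T.rho X ^ 2 + T.bF (X 0) * T.rho X + T.cF (X 0) = N at hN ⊢
    -- The value of `ρ̇` is irrelevant: it cancels from the wedge.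
    generalize -((T.rho X + T.pF (X 0)) * (T.rho X + T.qF (X 0)) / T.logD (X 0)) = ρt
    field_simp
    push_cast
    ring
  have z2 : pd 2 T.chi X = 0 ∧ pd 2 T.ratio X = 0 := by rw [h1, h2]; simp
  have z3 : pd 3 T.chi X = 0 ∧ pd 3 T.ratio X = 0 := by rw [h1, h2]; simp
  constructor
  · intro h
    have := h 0 1
    rw [h01] at this
    refine (mul_eq_zero.1 this).resolve_left ?_
    exact div_ne_zero hR (pow_ne_zero 2 (mul_ne_zero hρ hN))
  · intro h
    rw [h, mul_zero] at h01
    intro i j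
    fin_cases i <;> fin_cases j <;> simp [z2, z3] <;> linarith

end
end TData

/-! ### From the sonic condition to the three constants. -/

theorem quadratic_coeff_eq_zero {a b c : ℝ} {s : Set ℝ} (hs : s.Infinite)
    (h : ∀ x ∈ s, a * x ^ 2 + b * x + c = 0) : a = 0 ∧ b = 0 ∧ c = 0 := by
  open Polynomial in
  have h0 : C a * X ^ 2 + C b * X + C c = (0 : ℝ[X]) :=
    Polynomial.eq_zero_of_infinite_isRoot _ (hs.mono fun x hx => by simpa using h x hx)
  have key := fun n => congrArg (fun p : Polynomial ℝ => p.coeff n) h0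
  have k0 := key 0
  have k1 := key 1
  have k2 := key 2
  simp [Polynomial.coeff_X, Polynomial.coeff_C] at k0 k1 k2
  exact ⟨k2, k1, k0⟩

theorem HasPd.continuousAt {i : Fin 4} {f : Pt → ℝ} {f' : ℝ} {X : Pt} (h : HasPd i f f' X) :
    ContinuousAt (fun s => f (Function.update X i s)) (X i) :=
  HasDerivAt.continuousAt h

namespace TData
variable {T : TData}

section
variable (hT : T.IsTModel)
include hT

/-- `ω̇/ω` is a Möbius function of `Q` whose determinant is, up to sign, the Wronskian. -/
theorem IsTModel.injOn_rhoF {τ : ℝ} (hτ : τ ∈ T.I) :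
    InjOn (T.rhoF τ) {r ∈ T.J | T.om τ r ≠ 0} := by
  rintro r ⟨hr, hr0⟩ s ⟨hs, hs0⟩ h
  refine hT.injOn_Q hr hs ?_
  have h1 : T.omt τ r / T.om τ r = T.omt τ s / T.om τ s := by
    refine mul_left_cancel₀ (hT.logD_ne_zero hτ) ?_
    simp only [rhoF] at h
    linarith
  rw [div_eq_div_iff hr0 hs0] at h1
  simp only [om, omt] at h1
  refine sub_eq_zero.1 ((mul_eq_zero.1 ?_).resolve_left (hT.wronskian τ hτ))
  linear_combination h1

theorem IsTModel.mem_regular_iff {X : Pt} : X ∈ T.regular ↔ X ∈ T.domain ∧ T.rho X ≠ 0 ∧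
    T.rho X + T.pF (X 0) ≠ 0 ∧ T.rho X + T.qF (X 0) ≠ 0 := by
  simp only [regular, mem_ofPred_eq]
  refine and_congr_right fun hX => and_congr_right fun _ => ?_
  rw [hT.uDer_rho hX]
  simp [hT.logD_ne_zero hX.1]

theorem IsTModel.coeff_eq_zero (h : ∀ X ∈ T.regular, WedgeZero T.chi T.ratio X) {τ : ℝ}
    (hτ : τ ∈ T.I) : T.pF τ * deriv T.aF τ + 2 * T.aF τ * deriv T.pF τ = 0 ∧
      T.pF τ * deriv T.bF τ + T.bF τ * deriv T.pF τ = 0 ∧ T.pF τ * deriv T.cF τ = 0 := by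
  -- The discarded densities `0`, `-p`, `-q` are exactly those of the non-regular points.
  have hinf := ((hT.infinite_om_ne_zero hτ).image (hT.injOn_rhoF hτ)).sdiff
    (Set.toFinite {0, -T.pF τ, -T.qF τ})
  refine quadratic_coeff_eq_zero hinf ?_
  rintro _ ⟨⟨r, ⟨hr, hr0⟩, rfl⟩, hne⟩
  simp only [mem_insert_iff, mem_singleton_iff, not_or] at hne
  have hX := mk_mem_domain hτ hr hr0
  have hρ : T.rho ![τ, r, 0, 0] = T.rhoF τ r := hT.reg.rho_eq hX
  have hreg : ![τ, r, 0, 0] ∈ T.regular := by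
    rw [hT.mem_regular_iff, hρ]
    exact ⟨hX, hne.1, fun h => hne.2.1 (eq_neg_of_add_eq_zero_left h),
      fun h => hne.2.2 (eq_neg_of_add_eq_zero_left h)⟩
  have := (hT.wedgeZero_iff hreg).1 (h _ hreg)
  rwa [hρ] at this

theorem IsTModel.sonicConstants_iff {c₁ c₂ c₃ : ℝ} : T.SonicConstants c₁ c₂ c₃ ↔
    ∀ τ ∈ T.I, T.aF τ * T.pF τ ^ 2 = c₁ ∧ T.bF τ * T.pF τ = c₂ ∧ T.cF τ = c₃ := by
  have key : ∀ X ∈ T.domain, T.coeffA X = T.aF (X 0) ∧ T.coeffB X = T.bF (X 0) ∧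
      T.coeffC X = T.cF (X 0) ∧ T.prs X = T.pF (X 0) := by
    intro X hX
    have hA : T.coeffA X = T.aF (X 0) := by rw [coeffA, hT.uDer_prs hX, aF, logD]
    have hp := hT.prs_eq hX
    exact ⟨hA, by rw [coeffB, hA, hp]; rfl, by rw [coeffC, hA, hp]; rfl, hp⟩
  constructor
  · intro h τ hτ
    obtain ⟨X, hX, rfl⟩ := hT.exists_mem_domain hτ
    obtain ⟨hA, hB, hC, hp⟩ := key X hX
    have := h X hX
    rwa [hA, hB, hC, hp] at this
  · intro h X hX
    obtain ⟨hA, hB, hC, hp⟩ := key X hX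
    rw [hA, hB, hC, hp]
    exact h _ hX.1

theorem IsTModel.aF_ne_zero {τ : ℝ} (hτ : τ ∈ T.I) : T.aF τ ≠ 0 :=
  neg_ne_zero.2 (one_div_ne_zero (mul_ne_zero (hT.logD_ne_zero hτ) (hT.deriv_pF_ne_zero hτ)))

/-- Since `𝒜` never vanishes, a single zero of `p` would give `c = 0`, hence `p = 0` throughout,
against `ṗ ≠ 0`. -/
theorem IsTModel.pF_ne_zero {c : ℝ} (h : ∀ τ ∈ T.I, T.aF τ * T.pF τ ^ 2 = c) {τ : ℝ}
    (hτ : τ ∈ T.I) : T.pF τ ≠ 0 := by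
  intro h0
  have hc : c = 0 := by rw [← h τ hτ, h0]; ring
  have hp : ∀ s ∈ T.I, T.pF s = 0 := by
    intro s hs
    have := h s hs
    rw [hc] at this
    simpa [hT.aF_ne_zero hs] using this
  refine hT.deriv_pF_ne_zero hτ ?_
  have e : T.pF =ᶠ[nhds τ] fun _ => 0 := Filter.eventually_of_mem (hT.I_open.mem_nhds hτ) hp
  rw [e.deriv_eq, deriv_const]

theorem IsTModel.exists_sonicConstants (h : ∀ X ∈ T.regular, WedgeZero T.chi T.ratio X) :
    ∃ c₁ c₂ c₃, T.SonicConstants c₁ c₂ c₃ := by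
  have ha := fun τ (hτ : τ ∈ T.I) => hT.contDiffOn_aF.hasDerivAt_of_isOpen hT.I_open hτ
  have hb := fun τ (hτ : τ ∈ T.I) => hT.contDiffOn_bF.hasDerivAt_of_isOpen hT.I_open hτ
  have hc := fun τ (hτ : τ ∈ T.I) => hT.contDiffOn_cF.hasDerivAt_of_isOpen hT.I_open hτ
  have hp := fun τ (hτ : τ ∈ T.I) => hT.reg.hasDerivAt_pF hτ
  have const : ∀ f : ℝ → ℝ, (∀ τ ∈ T.I, HasDerivAt f 0 τ) → ∃ c, ∀ τ ∈ T.I, f τ = c := by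
    intro f hf
    exact hT.I_open.exists_is_const_of_deriv_eq_zero hT.I_conn.isPreconnected
      (fun τ hτ => (hf τ hτ).differentiableAt.differentiableWithinAt) fun τ hτ => (hf τ hτ).deriv
  obtain ⟨c₁, h₁⟩ := const (fun τ => T.aF τ * T.pF τ ^ 2) fun τ hτ =>
    ((ha τ hτ).fun_mul ((hp τ hτ).fun_pow 2)).congr_deriv (by
      push_cast
      linear_combination T.pF τ * (hT.coeff_eq_zero h hτ).1)
  obtain ⟨c₂, h₂⟩ := const (fun τ => T.bF τ * T.pF τ) fun τ hτ =>
    ((hb τ hτ).fun_mul (hp τ hτ)).congr_deriv (by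
      linear_combination (hT.coeff_eq_zero h hτ).2.1)
  -- The coefficient only gives `p 𝒞̇ = 0`; the first constant is what guarantees `p ≠ 0`.
  obtain ⟨c₃, h₃⟩ := const T.cF fun τ hτ => (hc τ hτ).congr_deriv
    ((mul_eq_zero.1 (hT.coeff_eq_zero h hτ).2.2).resolve_left (hT.pF_ne_zero h₁ hτ))
  exact ⟨c₁, c₂, c₃, hT.sonicConstants_iff.2 fun τ hτ => ⟨h₁ τ hτ, h₂ τ hτ, h₃ τ hτ⟩⟩

end

/-! ### Consequences of the three constants, and the dichotomy in `k`. -/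

section
variable (hT : T.IsTModel) {c₁ c₂ c₃ : ℝ} (hc : T.SonicConstants c₁ c₂ c₃)
include hT hc

theorem IsTModel.aF_eq {τ : ℝ} (hτ : τ ∈ T.I) : T.aF τ * T.pF τ ^ 2 = c₁ :=
  (hT.sonicConstants_iff.1 hc τ hτ).1

theorem IsTModel.pF_ne {τ : ℝ} (hτ : τ ∈ T.I) : T.pF τ ≠ 0 :=
  hT.pF_ne_zero (fun _ h => hT.aF_eq hc h) hτ

theorem IsTModel.c₁_ne_zero : c₁ ≠ 0 := by
  obtain ⟨τ, hτ⟩ := hT.I_conn.nonempty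
  rw [← hT.aF_eq hc hτ]
  exact mul_ne_zero (hT.aF_ne_zero hτ) (pow_ne_zero 2 (hT.pF_ne hc hτ))

theorem IsTModel.wedgeZero {X : Pt} (hX : X ∈ T.regular) : WedgeZero T.chi T.ratio X := by
  rw [hT.wedgeZero_iff hX]
  have hτ := hX.1.1
  have h := hT.sonicConstants_iff.1 hc
  have ha := hT.contDiffOn_aF.hasDerivAt_of_isOpen hT.I_open hτ
  have hb := hT.contDiffOn_bF.hasDerivAt_of_isOpen hT.I_open hτ
  have hc' := hT.contDiffOn_cF.hasDerivAt_of_isOpen hT.I_open hτ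
  have hp := hT.reg.hasDerivAt_pF hτ
  have const : ∀ (f : ℝ → ℝ) (c f' : ℝ), (∀ τ ∈ T.I, f τ = c) → HasDerivAt f f' (X 0) → f' = 0 := by
    intro f c f' hf hd
    refine hd.unique ((hasDerivAt_const (X 0) c).congr_of_eventuallyEq ?_)
    exact Filter.eventually_of_mem (hT.I_open.mem_nhds hτ) hf
  have e1 := const _ c₁ _ (fun τ hτ => (h τ hτ).1) (ha.fun_mul (hp.fun_pow 2))
  have e2 := const _ c₂ _ (fun τ hτ => (h τ hτ).2.1) (hb.fun_mul hp)
  have e3 := const _ c₃ _ (fun τ hτ => (h τ hτ).2.2) hc'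
  have e1' : T.pF (X 0) * deriv T.aF (X 0) + 2 * T.aF (X 0) * deriv T.pF (X 0) = 0 := by
    refine (mul_eq_zero.1 ?_).resolve_left (hT.pF_ne hc hτ)
    push_cast at e1
    linear_combination e1
  rw [e1', e3, mul_comm (T.pF (X 0)) (deriv T.bF (X 0)), e2]
  ring

theorem IsTModel.chi_eq_ratio {X : Pt} (hX : X ∈ T.regular) :
    T.chi X = T.ratio X ^ 2 / (c₁ + c₂ * T.ratio X + c₃ * T.ratio X ^ 2) := by
  obtain ⟨h1, h2, h3⟩ := hT.sonicConstants_iff.1 hc _ hX.1.1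
  have hp := hT.pF_ne hc hX.1.1
  have hρ := hX.2.1
  have hN := hT.denom_ne_zero hX
  rw [hT.chi_eq hX.1, ratio, hT.prs_eq hX.1, ← h1, ← h2, ← h3]
  have e : T.aF (X 0) * T.pF (X 0) ^ 2 + T.bF (X 0) * T.pF (X 0) * (T.pF (X 0) / T.rho X)
      + T.cF (X 0) * (T.pF (X 0) / T.rho X) ^ 2 = (T.pF (X 0) / T.rho X) ^ 2 *
      (T.aF (X 0) * T.rho X ^ 2 + T.bF (X 0) * T.rho X + T.cF (X 0)) := by
    field_simp
  rw [e]
  have hπ : (T.pF (X 0) / T.rho X) ^ 2 ≠ 0 := pow_ne_zero 2 (div_ne_zero hp hρ)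
  generalize T.aF (X 0) * T.rho X ^ 2 + T.bF (X 0) * T.rho X + T.cF (X 0) = N at hN ⊢
  rw [div_mul_eq_div_div, div_self hπ]

theorem IsTModel.denom_ratio_ne_zero {X : Pt} (hX : X ∈ T.regular) :
    c₁ + c₂ * T.ratio X + c₃ * T.ratio X ^ 2 ≠ 0 := by
  intro h
  have := hT.chi_eq_ratio hc hX
  rw [h, div_zero, hT.chi_eq hX.1] at this
  exact one_div_ne_zero (hT.denom_ne_zero hX) this

/-- If `χ = π` near a regular point, then varying `r` alone produces infinitely many values of `π`,
all roots of `c₃π² + (c₂ - 1)π + c₁`; this contradicts `c₁ ≠ 0`. -/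
theorem IsTModel.regular_subset_closure :
    T.regular ⊆ closure {X ∈ T.regular | T.chi X ≠ T.ratio X} := by
  intro X hX
  by_contra hcl
  have hd := hX.1
  have hreg := hT.mem_regular_iff.1 hX
  have hcont := (hT.hasPd_rho hd 1).continuousAt
  have hupd := tendsto_update 1 X
  have ev1 := hupd.eventually (hT.reg.isOpen_domain.mem_nhds hd)
  have ev2 := hupd.eventually (isClosed_closure.isOpen_compl.mem_nhds hcl)
  -- Used with `c = 0`, `p`, `q`, which are constant along the radial line; together these keep the
  -- line regular near the point.
  have ne : ∀ c : ℝ, T.rho X + c ≠ 0 →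
      ∀ᶠ s in nhds (X 1), T.rho (Function.update X 1 s) + c ≠ 0 := by
    intro c h
    exact (hcont.add continuousAt_const).eventually_ne (by simpa using h)
  have ev := ev1.and (ev2.and ((ne 0 (by simpa using hreg.2.1)).and
    ((ne _ hreg.2.2.1).and (ne _ hreg.2.2.2))))
  have h0 : ∀ s, Function.update X 1 s 0 = X 0 := fun s => by simp
  have h1 : ∀ s, Function.update X 1 s 1 = s := fun s => by simp
  have hinf := infinite_of_mem_nhds _ ev
  have hinj : InjOn (fun s => T.ratio (Function.update X 1 s)) {s | Function.update X 1 s ∈ T.domain ∧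
      Function.update X 1 s ∈ (closure {X ∈ T.regular | T.chi X ≠ T.ratio X})ᶜ ∧
      T.rho (Function.update X 1 s) + 0 ≠ 0 ∧ T.rho (Function.update X 1 s) + T.pF (X 0) ≠ 0 ∧
      T.rho (Function.update X 1 s) + T.qF (X 0) ≠ 0} := by
    rintro s ⟨hs, -, hs0, -⟩ t ⟨ht, -, ht0, -⟩ hst
    rw [add_zero] at hs0 ht0
    simp only [ratio] at hst
    rw [hT.prs_eq hs, hT.prs_eq ht, h0, h0, div_eq_div_iff hs0 ht0] at hst
    have hρ := mul_left_cancel₀ (hT.pF_ne hc hd.1) hst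
    rw [hT.reg.rho_eq hs, hT.reg.rho_eq ht, h0, h0, h1, h1] at hρ
    have ms : s ∈ {r ∈ T.J | T.om (X 0) r ≠ 0} := by
      have := hs.2.2.1
      have := hs.2.1
      simp_all
    have mt : t ∈ {r ∈ T.J | T.om (X 0) r ≠ 0} := by
      have := ht.2.2.1
      have := ht.2.1
      simp_all
    exact (hT.injOn_rhoF hd.1 ms mt hρ.symm)
  refine hT.c₁_ne_zero hc (quadratic_coeff_eq_zero (a := c₃) (b := c₂ - 1) (hinf.image hinj) ?_).2.2
  rintro _ ⟨s, ⟨hs, hcl', hs0, hs1, hs2⟩, rfl⟩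
  rw [add_zero] at hs0
  have hr : Function.update X 1 s ∈ T.regular := by
    rw [hT.mem_regular_iff, h0]
    exact ⟨hs, hs0, hs1, hs2⟩
  have he : T.chi (Function.update X 1 s) = T.ratio (Function.update X 1 s) := by
    by_contra hne
    exact hcl' (subset_closure ⟨hr, hne⟩)
  have hπ : T.ratio (Function.update X 1 s) ≠ 0 := by
    rw [ratio, hT.prs_eq hs, h0]
    exact div_ne_zero (hT.pF_ne hc hd.1) hs0
  rw [hT.chi_eq_ratio hc hr, div_eq_iff (hT.denom_ratio_ne_zero hc hr)] at he
  refine (mul_eq_zero.1 ?_).resolve_left hπ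
  show T.ratio (Function.update X 1 s) * (c₃ * T.ratio (Function.update X 1 s) ^ 2
    + (c₂ - 1) * T.ratio (Function.update X 1 s) + c₁) = 0
  linear_combination -he

theorem IsTModel.idealSonic : T.IdealSonic :=
  ⟨fun _ hX => hT.wedgeZero hc hX, hT.regular_subset_closure hc⟩

theorem IsTModel.c₁_mul_qF {τ : ℝ} (hτ : τ ∈ T.I) : c₁ * T.qF τ = c₃ * T.pF τ := by
  obtain ⟨h1, -, h3⟩ := hT.sonicConstants_iff.1 hc τ hτ
  rw [← h1, ← h3, cF]
  ring

theorem IsTModel.c₂_eq : c₂ = c₁ + c₃ := by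
  obtain ⟨τ, hτ⟩ := hT.I_conn.nonempty
  obtain ⟨h1, h2, h3⟩ := hT.sonicConstants_iff.1 hc τ hτ
  rw [← h1, ← h2, ← h3, bF, cF]
  ring

theorem IsTModel.c₁_mul_deriv_pF {τ : ℝ} (hτ : τ ∈ T.I) :
    c₁ * (T.logD τ * deriv T.pF τ) = -T.pF τ ^ 2 := by
  have hb := hT.logD_ne_zero hτ
  have hp := hT.deriv_pF_ne_zero hτ
  rw [← hT.aF_eq hc hτ, aF]
  field_simp

/-- Differentiate `c₁ q = c₃ p` and multiply by `c₁ b`. Then `c₁ b ṗ = -p²` and `b² = (4/3)(q +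
k/φ)` remove all derivatives, and `c₁ q = c₃ p` removes `q`. -/
theorem IsTModel.sonic_quadratic {τ : ℝ} (hτ : τ ∈ T.I) :
    (c₃ * T.pF τ + c₁ * (T.k / T.φ τ)) *
      (2 * (c₁ + c₃) * T.pF τ + 8 / 3 * c₁ * (T.k / T.φ τ)) = c₃ * T.pF τ ^ 2 := by
  have hp := hT.reg.hasDerivAt_pF hτ
  have hq := hT.reg.hasDerivAt_qF hτ
  have e : (fun s => c₁ * T.qF s) =ᶠ[nhds τ] fun s => c₃ * T.pF s :=
    Filter.eventually_of_mem (hT.I_open.mem_nhds hτ) fun s hs => hT.c₁_mul_qF hc hs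
  have h1 := (hq.const_mul c₁).unique ((hp.const_mul c₃).congr_of_eventuallyEq e)
  have h2 := hT.c₁_mul_deriv_pF hc hτ
  have h3 := hT.c₁_mul_qF hc hτ
  have h4 : T.logD τ ^ 2 = 4 / 3 * (T.qF τ + T.k / T.φ τ) := by
    simp only [qF]
    ring
  have h5 : c₁ ^ 2 * T.logD τ ^ 2 * (-(3 / 2) * (T.pF τ + T.qF τ) - 2 * (T.k / T.φ τ)) =
      -c₃ * T.pF τ ^ 2 := by
    linear_combination c₁ * T.logD τ * h1 + c₃ * h2
  rw [h4] at h5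
  rw [← h3]
  have : c₁ ^ 2 * (T.qF τ + T.k / T.φ τ) * (2 * (T.pF τ + T.qF τ) + 8 / 3 * (T.k / T.φ τ))
      = c₃ * T.pF τ ^ 2 := by linear_combination -h5
  linear_combination this - 2 * (c₁ * T.qF τ + c₁ * (T.k / T.φ τ)) * h3

theorem IsTModel.c₁_add_c₃ (hk : T.k = 0) : c₃ ≠ 0 ∧ c₁ + c₃ = 1 / 2 := by
  obtain ⟨τ, hτ⟩ := hT.I_conn.nonempty
  have hp := hT.pF_ne hc hτ
  have h3 : c₃ ≠ 0 := by
    intro h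
    have := hT.c₁_mul_qF hc hτ
    simp [h, hT.c₁_ne_zero hc, qF, hk, hT.logD_ne_zero hτ] at this
  have h := hT.sonic_quadratic hc hτ
  rw [hk] at h
  refine ⟨h3, mul_left_cancel₀ (mul_ne_zero h3 (pow_ne_zero 2 hp)) ?_⟩
  linear_combination h / 2

/-- Divided by `p²`, the quadratic relation becomes an equation for `z = (k/φ)/p` with leading
coefficient `(8/3) c₁² ≠ 0`. So `z` takes finitely many values and is constant by continuity; then
`q`, and with it `b²`, is a constant multiple of `1/φ`. -/
theorem IsTModel.exists_deriv_φ_sq (hk : T.k ≠ 0) :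
    ∃ c₀ : ℝ, ∀ τ ∈ T.I, deriv T.φ τ ^ 2 = c₀ ^ 2 * T.φ τ := by
  have h1 := hT.c₁_ne_zero hc
  have hp := fun τ (hτ : τ ∈ T.I) => hT.pF_ne hc hτ
  have hφ := fun τ (hτ : τ ∈ T.I) => (hT.φ_pos τ hτ).ne'
  have hcont : ContinuousOn (fun τ => T.k / T.φ τ / T.pF τ) T.I :=
    (continuousOn_const.div hT.φ_smooth.continuousOn hφ).div
      hT.reg.contDiffOn_pF.continuousOn hp
  have hfin : ((fun τ => T.k / T.φ τ / T.pF τ) '' T.I).Finite := by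
    by_contra hinf
    have := (quadratic_coeff_eq_zero (a := 8 / 3 * c₁ ^ 2)
      (b := 8 / 3 * c₁ * c₃ + 2 * (c₁ + c₃) * c₁) (c := 2 * c₃ * (c₁ + c₃) - c₃) hinf ?_).1
    · simp [h1] at this
    · rintro _ ⟨τ, hτ, rfl⟩
      have h := hT.sonic_quadratic hc hτ
      refine mul_left_cancel₀ (pow_ne_zero 2 (hp τ hτ)) ?_
      have e : T.k / T.φ τ = T.k / T.φ τ / T.pF τ * T.pF τ := (div_mul_cancel₀ _ (hp τ hτ)).symm
      dsimp only
      generalize T.k / T.φ τ / T.pF τ = z at e ⊢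
      rw [e] at h
      linear_combination h
  -- A finite connected image has only one point.
  have hsub := hfin.countable.isTotallyDisconnected _ subset_rfl
    (hT.I_conn.isPreconnected.image _ hcont)
  obtain ⟨τ₀, hτ₀⟩ := hT.I_conn.nonempty
  set z := T.k / T.φ τ₀ / T.pF τ₀ with hz
  have hz0 : z ≠ 0 := div_ne_zero (div_ne_zero hk (hφ τ₀ hτ₀)) (hp τ₀ hτ₀)
  have key : ∀ τ ∈ T.I, deriv T.φ τ ^ 2 = 4 / 3 * (c₃ / (c₁ * z) + 1) * T.k * T.φ τ := by
    intro τ hτ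
    have hzτ : T.k / T.φ τ / T.pF τ = z :=
      hsub (mem_image_of_mem _ hτ) (mem_image_of_mem _ hτ₀)
    rw [div_eq_iff (hp τ hτ)] at hzτ
    have h4 : T.logD τ ^ 2 = 4 / 3 * (T.qF τ + T.k / T.φ τ) := by
      simp only [qF]
      ring
    have hq : T.qF τ = c₃ / (c₁ * z) * (T.k / T.φ τ) := by
      rw [hzτ]
      field_simp
      linear_combination hT.c₁_mul_qF hc hτ
    rw [hq, logD] at h4
    have := hφ τ hτ
    generalize c₃ / (c₁ * z) = w at h4 ⊢
    field_simp at h4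
    linear_combination h4 / 3
  -- The constant is a quotient of `φ̇²` by `φ > 0`, so it has the square root `c₀`.
  have hpos : 0 ≤ 4 / 3 * (c₃ / (c₁ * z) + 1) * T.k := by
    have h := key τ₀ hτ₀
    have := hT.φ_pos τ₀ hτ₀
    by_contra! hneg
    nlinarith [sq_nonneg (deriv T.φ τ₀), mul_neg_of_neg_of_pos hneg this]
  exact ⟨√(4 / 3 * (c₃ / (c₁ * z) + 1) * T.k), by rwa [Real.sq_sqrt hpos]⟩

end

/-! ### Models with `φ̇² = c₀² φ`. -/

section
variable (hT : T.IsTModel) {c₀ : ℝ} (h0 : ∀ τ ∈ T.I, deriv T.φ τ ^ 2 = c₀ ^ 2 * T.φ τ)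
include hT h0

theorem IsTModel.pF_eq_of_deriv_φ_sq {τ : ℝ} (hτ : τ ∈ T.I) :
    T.pF τ = -(c₀ ^ 2 + 4 * T.k) / 4 * (1 / T.φ τ) := by
  have hφ := (hT.φ_pos τ hτ).ne'
  have hd := hT.φ_deriv τ hτ
  have h1 := (hT.reg.hasDerivAt_dφ hτ).fun_pow 2
  have e : (fun s => deriv T.φ s ^ 2) =ᶠ[nhds τ] fun s => c₀ ^ 2 * T.φ s :=
    Filter.eventually_of_mem (hT.I_open.mem_nhds hτ) h0
  have h2 := h1.unique (((hT.reg.hasDerivAt_φ hτ).const_mul (c₀ ^ 2)).congr_of_eventuallyEq e)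
  -- The derivative of `φ̇² = c₀² φ` is `2 φ̇ φ̈ = c₀² φ̇`, and `φ̇ ≠ 0`.
  have h3 : deriv (deriv T.φ) τ = c₀ ^ 2 / 2 := by
    refine mul_left_cancel₀ hd ?_
    push_cast at h2
    linear_combination h2 / 2
  simp only [pF, logD]
  rw [div_pow, h0 τ hτ, h3]
  field_simp
  ring

/-- Here `p` and `q` are constant multiples of `1/φ` and `𝒜` is one of `φ²`, so `φ` drops out of all
three products. -/
theorem IsTModel.sonicConstants_of_deriv_φ_sq : ∃ c₁ c₂ c₃, T.SonicConstants c₁ c₂ c₃ := by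
  have hp := fun τ (hτ : τ ∈ T.I) => hT.pF_eq_of_deriv_φ_sq h0 hτ
  have hdp : ∀ τ ∈ T.I, deriv T.pF τ = (c₀ ^ 2 + 4 * T.k) / 4 * (T.logD τ / T.φ τ) := by
    intro τ hτ
    have hφ := (hT.φ_pos τ hτ).ne'
    refine HasDerivAt.deriv (HasDerivAt.congr_of_eventuallyEq ?_
      (Filter.eventually_of_mem (hT.I_open.mem_nhds hτ) hp))
    refine (((hasDerivAt_const τ 1).fun_div (hT.reg.hasDerivAt_φ hτ) hφ).const_mul
      (-(c₀ ^ 2 + 4 * T.k) / 4)).congr_deriv ?_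
    simp only [logD]
    field_simp
    ring
  obtain ⟨τ₀, hτ₀⟩ := hT.I_conn.nonempty
  have hP : c₀ ^ 2 + 4 * T.k ≠ 0 := by
    intro h
    have := hdp τ₀ hτ₀
    rw [h] at this
    exact hT.deriv_pF_ne_zero hτ₀ (by simpa using this)
  have hc : c₀ ≠ 0 := by
    rintro rfl
    have := h0 τ₀ hτ₀
    simp [hT.φ_deriv τ₀ hτ₀] at this
  have ha : ∀ τ ∈ T.I, T.aF τ = -4 * T.φ τ ^ 2 / (c₀ ^ 2 * (c₀ ^ 2 + 4 * T.k)) := by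
    intro τ hτ
    have hφ := (hT.φ_pos τ hτ).ne'
    have hd := hT.φ_deriv τ hτ
    have e : T.logD τ * deriv T.pF τ = c₀ ^ 2 * (c₀ ^ 2 + 4 * T.k) / (4 * T.φ τ ^ 2) := by
      rw [hdp τ hτ, logD]
      field_simp
      linear_combination h0 τ hτ
    rw [aF, e]
    field_simp
  have hq : ∀ τ ∈ T.I, T.qF τ = (3 / 4 * c₀ ^ 2 - T.k) / T.φ τ := by
    intro τ hτ
    have hφ := (hT.φ_pos τ hτ).ne'
    rw [qF, logD, div_pow, h0 τ hτ]
    field_simp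
  refine ⟨-(c₀ ^ 2 + 4 * T.k) / (4 * c₀ ^ 2),
    (1 / c₀ ^ 2) * (-(c₀ ^ 2 + 4 * T.k) / 4 + (3 / 4 * c₀ ^ 2 - T.k)),
    (1 / c₀ ^ 2) * (3 / 4 * c₀ ^ 2 - T.k), hT.sonicConstants_iff.2 fun τ hτ => ?_⟩
  have hφ := (hT.φ_pos τ hτ).ne'
  rw [bF, cF, ha τ hτ, hp τ hτ, hq τ hτ]
  refine ⟨?_, ?_, ?_⟩
  all_goals field_simp

theorem IsTModel.prs_neg_iff {X : Pt} (hX : X ∈ T.domain) :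
    T.prs X < 0 ↔ 0 < c₀ ^ 2 + 4 * T.k := by
  have hφ : 0 < 1 / T.φ (X 0) := one_div_pos.2 (hT.φ_pos _ hX.1)
  rw [hT.prs_eq hX, hT.pF_eq_of_deriv_φ_sq h0 hX.1, mul_neg_iff]
  constructor
  · rintro (⟨-, h⟩ | ⟨h, -⟩) <;> linarith
  · intro h
    exact Or.inr ⟨by linarith, hφ⟩

end

theorem IsTModel.idealSonic_iff (hT : T.IsTModel) : T.IdealSonic ↔ T.CaseI ∨ T.CaseII := by
  constructor
  · rintro ⟨h, -⟩
    obtain ⟨c₁, c₂, c₃, hc⟩ := hT.exists_sonicConstants h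
    by_cases hk : T.k = 0
    · exact Or.inl ⟨hk, c₁, c₂, c₃, hc, hT.c₂_eq hc, (hT.c₁_add_c₃ hc hk).2⟩
    · exact Or.inr ⟨hk, hT.exists_deriv_φ_sq hc hk⟩
  · rintro (⟨-, c₁, c₂, c₃, hc, -⟩ | ⟨-, c₀, h0⟩)
    · exact hT.idealSonic hc
    · obtain ⟨c₁, c₂, c₃, hc⟩ := hT.sonicConstants_of_deriv_φ_sq h0
      exact hT.idealSonic hc

end TData

/-! ### The functions of the ideal models -/

/-- `Real.log` is even, so this single formula serves positive and negative times. -/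
theorem abs_rpow_eventuallyEq {t : ℝ} (ht : t ≠ 0) (s : ℝ) :
    (fun x : ℝ => |x| ^ s) =ᶠ[nhds t] fun x => Real.exp (Real.log x * s) := by
  filter_upwards [isOpen_ne.mem_nhds ht] with x hx
  rw [Real.rpow_def_of_pos (abs_pos.2 hx), Real.log_abs]

theorem hasDerivAt_abs_rpow_const {t : ℝ} (ht : t ≠ 0) (s : ℝ) :
    HasDerivAt (fun x : ℝ => |x| ^ s) (s * |t| ^ s / t) t := by
  refine ((((Real.hasDerivAt_log ht).mul_const s).exp).congr_of_eventuallyEq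
    (abs_rpow_eventuallyEq ht s)).congr_deriv ?_
  rw [Real.rpow_def_of_pos (abs_pos.2 ht), Real.log_abs]
  ring

theorem contDiffAt_abs_rpow_const {t : ℝ} (ht : t ≠ 0) (s : ℝ) :
    ContDiffAt ℝ ∞ (fun x : ℝ => |x| ^ s) t := by
  refine ContDiffAt.congr_of_eventuallyEq ?_ (abs_rpow_eventuallyEq ht s)
  exact ((Real.contDiffAt_log.2 ht).mul contDiffAt_const).exp

section
variable (γ : ℝ) {t : ℝ}

theorem idealPhi_pos (ht : t ≠ 0) : 0 < idealPhi γ t := Real.rpow_pos_of_pos (abs_pos.2 ht) _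

theorem sqrt_idealPhi (t : ℝ) : √(idealPhi γ t) = |t| ^ (2 / (3 * γ)) := by
  rw [idealPhi, Real.sqrt_eq_rpow, ← Real.rpow_mul (abs_nonneg t)]
  congr 1
  ring

theorem hasDerivAt_idealPhi (ht : t ≠ 0) :
    HasDerivAt (idealPhi γ) (4 / (3 * γ) * idealPhi γ t / t) t :=
  hasDerivAt_abs_rpow_const ht _

theorem hasDerivAt_deriv_idealPhi (ht : t ≠ 0) : HasDerivAt (deriv (idealPhi γ))
    (4 / (3 * γ) * (4 / (3 * γ) - 1) * idealPhi γ t / t ^ 2) t := by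
  have e : deriv (idealPhi γ) =ᶠ[nhds t] fun x => 4 / (3 * γ) * idealPhi γ x / x := by
    filter_upwards [isOpen_ne.mem_nhds ht] with x hx
    exact (hasDerivAt_idealPhi γ hx).deriv
  refine ((((hasDerivAt_idealPhi γ ht).const_mul _).fun_div (hasDerivAt_id' t)
    ht).congr_of_eventuallyEq e).congr_deriv ?_
  generalize 4 / (3 * γ) = n
  field_simp

variable {γ}

/-- For `γ = 2` the exponent is `0`, so both branches are one power law. In both, `α̃ = γ t α̇`,
which lets the logarithmic case be treated together with the others. -/
theorem idealAlphaTilde_eq (hγ : γ ≠ 0) (t : ℝ) :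
    idealAlphaTilde γ t = (if γ = 2 then 2 else γ - 2) * |t| ^ (1 - 2 / γ) := by
  unfold idealAlphaTilde idealAlpha
  split_ifs with h
  · subst h
    simp
  · rfl

theorem idealAlphaTilde_ne_zero (hγ : γ ≠ 0) (ht : t ≠ 0) : idealAlphaTilde γ t ≠ 0 := by
  rw [idealAlphaTilde_eq hγ]
  refine mul_ne_zero ?_ (Real.rpow_pos_of_pos (abs_pos.2 ht) _).ne'
  split_ifs with h
  · norm_num
  · exact sub_ne_zero.2 h

theorem hasDerivAt_idealAlpha (hγ : γ ≠ 0) (ht : t ≠ 0) :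
    HasDerivAt (idealAlpha γ) (idealAlphaTilde γ t / (γ * t)) t := by
  by_cases h : γ = 2
  · have e : idealAlpha γ = Real.log := by
      funext x
      simp [idealAlpha, h]
    rw [e]
    refine (Real.hasDerivAt_log ht).congr_deriv ?_
    simp only [idealAlphaTilde, h, if_true]
    field_simp
  · have e : idealAlpha γ = fun x => |x| ^ (1 - 2 / γ) := by
      funext x
      simp [idealAlpha, h]
    rw [e]
    refine (hasDerivAt_abs_rpow_const ht _).congr_deriv ?_
    simp only [idealAlphaTilde, h, if_false, e]
    field_simp

theorem hasDerivAt_idealAlphaTilde (hγ : γ ≠ 0) (ht : t ≠ 0) :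
    HasDerivAt (idealAlphaTilde γ) ((1 - 2 / γ) * idealAlphaTilde γ t / t) t := by
  have e : idealAlphaTilde γ = fun t => (if γ = 2 then 2 else γ - 2) * |t| ^ (1 - 2 / γ) :=
    funext (idealAlphaTilde_eq hγ)
  rw [e]
  refine ((hasDerivAt_abs_rpow_const ht _).const_mul _).congr_deriv ?_
  ring

theorem contDiffAt_idealAlpha (ht : t ≠ 0) : ContDiffAt ℝ ∞ (idealAlpha γ) t := by
  by_cases h : γ = 2
  · have e : idealAlpha γ = Real.log := by
      funext x
      simp [idealAlpha, h]
    rw [e]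
    exact Real.contDiffAt_log.2 ht
  · have e : idealAlpha γ = fun x => |x| ^ (1 - 2 / γ) := by
      funext x
      simp [idealAlpha, h]
    rw [e]
    exact contDiffAt_abs_rpow_const ht _

theorem contDiffAt_sqrt_idealPhi (ht : t ≠ 0) : ContDiffAt ℝ ∞ (fun t => √(idealPhi γ t)) t := by
  simp only [sqrt_idealPhi]
  exact contDiffAt_abs_rpow_const ht _

theorem hasDerivAt_sqrt_idealPhi (ht : t ≠ 0) :
    HasDerivAt (fun t => √(idealPhi γ t)) (2 / (3 * γ) * √(idealPhi γ t) / t) t := by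
  simp only [sqrt_idealPhi]
  exact hasDerivAt_abs_rpow_const ht _

/-- The derivative of `√φ (A α + B)`. -/
theorem hasDerivAt_sqrt_mul (A B : ℝ) (hγ : γ ≠ 0) (ht : t ≠ 0) :
    HasDerivAt (fun t => √(idealPhi γ t) * (A * idealAlpha γ t + B))
      (√(idealPhi γ t) * (2 / (3 * γ) * (A * idealAlpha γ t + B)
        + A * idealAlphaTilde γ t / γ) / t) t := by
  refine ((hasDerivAt_sqrt_idealPhi ht).fun_mul
    (((hasDerivAt_idealAlpha hγ ht).const_mul A).add_const B)).congr_deriv ?_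
  field_simp

theorem hasDerivAt_deriv_sqrt_mul (A B : ℝ) (hγ : γ ≠ 0) (ht : t ≠ 0) :
    HasDerivAt (deriv fun t => √(idealPhi γ t) * (A * idealAlpha γ t + B))
      (√(idealPhi γ t) * (2 / (3 * γ) * (2 / (3 * γ) - 1) * (A * idealAlpha γ t + B)
        - 2 / (3 * γ) * (A * idealAlphaTilde γ t / γ)) / t ^ 2) t := by
  have e : (deriv fun t => √(idealPhi γ t) * (A * idealAlpha γ t + B)) =ᶠ[nhds t]
      fun t => √(idealPhi γ t) * (2 / (3 * γ) * (A * idealAlpha γ t + B)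
        + A * idealAlphaTilde γ t / γ) / t := by
    filter_upwards [isOpen_ne.mem_nhds ht] with x hx
    exact (hasDerivAt_sqrt_mul A B hγ hx).deriv
  refine ((((hasDerivAt_sqrt_idealPhi ht).fun_mul
    (((((hasDerivAt_idealAlpha hγ ht).const_mul A).add_const B).const_mul (2 / (3 * γ))).add
      (((hasDerivAt_idealAlphaTilde hγ ht).const_mul A).div_const γ))).fun_div (hasDerivAt_id' t)
    ht).congr_of_eventuallyEq e).congr_deriv ?_
  simp only [Pi.add_apply]
  field_simp
  ring

end

/-- As `c₂ = c₁ + c₃`, the denominator has the root `-1`; the other root is `1 - γ`. -/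
theorem sq_div_eq_idealChi {γ : ℝ} (hγ : γ ≠ 0) (π : ℝ) :
    π ^ 2 / ((γ - 1) / (2 * γ) + 1 / 2 * π + 1 / (2 * γ) * π ^ 2) = idealChi γ π := by
  have e : (γ - 1) / (2 * γ) + 1 / 2 * π + 1 / (2 * γ) * π ^ 2 =
      (π + 1) * (π + γ - 1) / (2 * γ) := by
    field_simp
    ring
  rw [e, idealChi, div_div_eq_mul_div, mul_comm (π ^ 2)]

/-- With `γ = 1 + s`, `s > 0`, each of the three quantities becomes a quotient whose factors are
visibly positive for `0 < π < 1`. -/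
theorem compressG_idealChi {γ π : ℝ} (hγ : 1 < γ) (h0 : 0 < π) (h1 : π < 1) :
    CompressG (idealChi γ) π := by
  obtain ⟨s, hs, rfl⟩ : ∃ s : ℝ, 0 < s ∧ γ = 1 + s := ⟨γ - 1, by linarith, by ring⟩
  have hD : 0 < (π + 1) * (π + (1 + s) - 1) := by
    have : 0 < π + (1 + s) - 1 := by linarith
    positivity
  have hE : 0 < π + s := by linarith
  have hF : 0 < 1 - π := by linarith
  have hd : HasDerivAt (idealChi (1 + s)) (2 * (1 + s) * π * ((1 + s) * π + 2 * s)
      / ((π + 1) * (π + s)) ^ 2) π := by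
    have hn := ((hasDerivAt_id' π).fun_pow 2).const_mul (2 * (1 + s))
    have hm := ((hasDerivAt_id' π).add_const 1).fun_mul
      (((hasDerivAt_id' π).add_const (1 + s)).sub_const 1)
    refine (hn.fun_div hm hD.ne').congr_deriv ?_
    rw [show π + (1 + s) - 1 = π + s by ring]
    push_cast
    field_simp
    ring
  have hc : idealChi (1 + s) π = 2 * (1 + s) * π ^ 2 / ((π + 1) * (π + s)) := by
    rw [idealChi]
    congr 2
    ring
  have hc1 : 1 - idealChi (1 + s) π = (1 - π) * ((1 + 2 * s) * π + s) / ((π + 1) * (π + s)) := by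
    rw [hc]
    field_simp
    ring
  refine ⟨?_, ?_, ?_⟩
  · rw [hc]
    positivity
  · rw [← sub_pos, hc1]
    positivity
  · rw [hc1, hd.deriv, hc]
    have e : (1 + π) * (2 * (1 + s) * π ^ 2 / ((π + 1) * (π + s)) - π) *
        (2 * (1 + s) * π * ((1 + s) * π + 2 * s) / ((π + 1) * (π + s)) ^ 2) +
        2 * (2 * (1 + s) * π ^ 2 / ((π + 1) * (π + s))) *
          ((1 - π) * ((1 + 2 * s) * π + s) / ((π + 1) * (π + s))) =
        2 * (1 + s) * π ^ 2 * (1 - π) * ((5 * s + 3) * π ^ 2 + (3 * s ^ 2 + 5 * s) * π) /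
          ((π + 1) ^ 2 * (π + s) ^ 3) := by
      field_simp
      ring
    rw [e]
    positivity

/-! ### The ideal models -/

namespace TData

section
variable {γ : ℝ} {I J : Set ℝ} {Q : ℝ → ℝ} (h : IdealAdmissible γ I J Q)

theorem ideal_om (τ r : ℝ) :
    (idealT γ I J Q).om τ r = √(idealPhi γ τ) * (idealAlpha γ τ + Q r) := by
  simp only [om, idealT]
  ring

/-- The trivial coefficients put `ω₁` and `ω₂` in the shape of `hasDerivAt_sqrt_mul`, with `(A, B) =
(1, 0)` and `(0, 1)`. -/
theorem ideal_ω₁ : (idealT γ I J Q).ω₁ =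
    fun t => √(idealPhi γ t) * (1 * idealAlpha γ t + 0) := by
  simp [idealT]

theorem ideal_ω₂ : (idealT γ I J Q).ω₂ =
    fun t => √(idealPhi γ t) * (0 * idealAlpha γ t + 1) := by
  simp [idealT]

include h

theorem _root_.IdealAdmissible.ne_zero {τ : ℝ} (hτ : τ ∈ I) : τ ≠ 0 := by
  obtain ⟨-, -, -, -, -, -, hI | hI, -⟩ := h
  · exact (hI hτ).ne'
  · exact (hI hτ).ne

theorem ideal_reg : (idealT γ I J Q).Reg where
  I_open := h.2.2.1
  J_open := h.2.2.2.2.1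
  φ_smooth := fun _ hτ => (contDiffAt_abs_rpow_const (h.ne_zero hτ) _).contDiffWithinAt
  ω₁_smooth := fun _ hτ => ((contDiffAt_sqrt_idealPhi (h.ne_zero hτ)).mul
    (contDiffAt_idealAlpha (h.ne_zero hτ))).contDiffWithinAt
  ω₂_smooth := fun _ hτ => (contDiffAt_sqrt_idealPhi (h.ne_zero hτ)).contDiffWithinAt
  Q_smooth := h.2.2.2.2.2.2.2.1
  φ_pos := fun _ hτ => idealPhi_pos γ (h.ne_zero hτ)

variable {τ : ℝ} (hτ : τ ∈ I)
include hτ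

theorem ideal_logD : (idealT γ I J Q).logD τ = 4 / (3 * γ) / τ := by
  have h0 := h.ne_zero hτ
  have hφ := (idealPhi_pos γ h0).ne'
  have e : (idealT γ I J Q).logD τ = deriv (idealPhi γ) τ / idealPhi γ τ := rfl
  rw [e, (hasDerivAt_idealPhi γ h0).deriv]
  field_simp

theorem ideal_ddφ : deriv (deriv (idealT γ I J Q).φ) τ / (idealT γ I J Q).φ τ =
    4 / (3 * γ) * (4 / (3 * γ) - 1) / τ ^ 2 := by
  have h0 := h.ne_zero hτ
  have hφ := (idealPhi_pos γ h0).ne'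
  have e : deriv (deriv (idealT γ I J Q).φ) τ / (idealT γ I J Q).φ τ =
    deriv (deriv (idealPhi γ)) τ / idealPhi γ τ := rfl
  rw [e, (hasDerivAt_deriv_idealPhi γ h0).deriv]
  field_simp

theorem ideal_pF : (idealT γ I J Q).pF τ = 4 * (γ - 1) / (3 * γ ^ 2) / τ ^ 2 := by
  have h0 := h.ne_zero hτ
  have hγ := h.1
  have hk : (idealT γ I J Q).k = 0 := rfl
  rw [pF, ideal_logD h hτ, ideal_ddφ h hτ, hk]
  field_simp
  ring

theorem ideal_qF : (idealT γ I J Q).qF τ = 4 / (3 * γ ^ 2) / τ ^ 2 := by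
  have h0 := h.ne_zero hτ
  have hγ := h.1
  have hk : (idealT γ I J Q).k = 0 := rfl
  rw [qF, ideal_logD h hτ, hk]
  field_simp
  ring

theorem ideal_omt (r : ℝ) : (idealT γ I J Q).omt τ r = √(idealPhi γ τ) *
    (2 / (3 * γ) * (idealAlpha γ τ + Q r) + idealAlphaTilde γ τ / γ) / τ := by
  have h0 := h.ne_zero hτ
  have hγ := h.1
  rw [omt, ideal_ω₁, ideal_ω₂, (hasDerivAt_sqrt_mul 1 0 hγ h0).deriv,
    (hasDerivAt_sqrt_mul 0 1 hγ h0).deriv]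
  simp only [idealT]
  ring

theorem ideal_omtt (r : ℝ) : (idealT γ I J Q).omtt τ r = √(idealPhi γ τ) *
    (2 / (3 * γ) * (2 / (3 * γ) - 1) * (idealAlpha γ τ + Q r)
      - 2 / (3 * γ) * (idealAlphaTilde γ τ / γ)) / τ ^ 2 := by
  have h0 := h.ne_zero hτ
  have hγ := h.1
  rw [omtt, ideal_ω₁, ideal_ω₂, (hasDerivAt_deriv_sqrt_mul 1 0 hγ h0).deriv,
    (hasDerivAt_deriv_sqrt_mul 0 1 hγ h0).deriv]
  simp only [idealT]
  ring

theorem ideal_deriv_pF :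
    deriv (idealT γ I J Q).pF τ = -(8 * (γ - 1) / (3 * γ ^ 2)) / τ ^ 3 := by
  have h0 := h.ne_zero hτ
  have hγ := h.1
  have e : (idealT γ I J Q).pF =ᶠ[nhds τ] fun t => 4 * (γ - 1) / (3 * γ ^ 2) / t ^ 2 :=
    Filter.eventually_of_mem (h.2.2.1.mem_nhds hτ) fun _ hs => ideal_pF h hs
  rw [e.deriv_eq]
  refine ((hasDerivAt_const τ (4 * (γ - 1) / (3 * γ ^ 2))).fun_div ((hasDerivAt_id' τ).fun_pow 2)
    (pow_ne_zero 2 h0)).deriv.trans ?_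
  field_simp
  push_cast
  ring

end

theorem ideal_add_ne_zero {γ : ℝ} {I J : Set ℝ} {Q : ℝ → ℝ} {X : Pt}
    (hX : X ∈ (idealT γ I J Q).domain) :
    idealAlpha γ (X 0) + Q (X 1) ≠ 0 := by
  have := hX.2.2.1
  rw [ideal_om] at this
  exact (mul_ne_zero_iff.1 this).2

section
variable {γ : ℝ} {I J : Set ℝ} {Q : ℝ → ℝ} (h : IdealAdmissible γ I J Q)
include h

theorem ideal_perfectFluidAt {X : Pt} (hX : X ∈ (idealT γ I J Q).domain) :
    (idealT γ I J Q).PerfectFluidAt X := by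
  have h0 := h.ne_zero hX.1
  have hγ := h.1
  have hv := ideal_add_ne_zero hX
  have hφ := (Real.sqrt_pos.2 (idealPhi_pos γ h0)).ne'
  rw [(ideal_reg h).perfectFluidAt_iff hX, ideal_pF h hX.1, pTan, ideal_omt h hX.1,
    ideal_omtt h hX.1, ideal_om, ideal_ddφ h hX.1, ideal_logD h hX.1]
  field_simp
  ring

theorem ideal_prs {X : Pt} (hX : X ∈ (idealT γ I J Q).domain) :
    (idealT γ I J Q).prs X = (idealT γ I J Q).pF (X 0) := by
  rw [(ideal_reg h).prs_eq hX, ((ideal_reg h).perfectFluidAt_iff hX).1 (ideal_perfectFluidAt h hX)]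
  ring

theorem ideal_isTModel : (idealT γ I J Q).IsTModel where
  k_mem := Or.inl rfl
  I_open := h.2.2.1
  I_conn := h.2.2.2.1
  J_open := h.2.2.2.2.1
  J_conn := h.2.2.2.2.2.1
  φ_smooth := (ideal_reg h).φ_smooth
  ω₁_smooth := (ideal_reg h).ω₁_smooth
  ω₂_smooth := (ideal_reg h).ω₂_smooth
  Q_smooth := (ideal_reg h).Q_smooth
  φ_pos := (ideal_reg h).φ_pos
  wronskian := by
    intro τ hτ
    have h0 := h.ne_zero hτ
    have hγ := h.1
    have hφ := (Real.sqrt_pos.2 (idealPhi_pos γ h0)).ne'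
    rw [ideal_ω₁, ideal_ω₂, (hasDerivAt_sqrt_mul 1 0 hγ h0).deriv,
      (hasDerivAt_sqrt_mul 0 1 hγ h0).deriv]
    have e : √(idealPhi γ τ) * (1 * idealAlpha γ τ + 0) *
        (√(idealPhi γ τ) * (2 / (3 * γ) * (0 * idealAlpha γ τ + 1)
          + 0 * idealAlphaTilde γ τ / γ) / τ) -
        √(idealPhi γ τ) * (2 / (3 * γ) * (1 * idealAlpha γ τ + 0)
          + 1 * idealAlphaTilde γ τ / γ) / τ * (√(idealPhi γ τ) * (0 * idealAlpha γ τ + 1)) =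
        -(√(idealPhi γ τ) ^ 2 * idealAlphaTilde γ τ / (γ * τ)) := by
      field_simp
      ring
    rw [e]
    exact neg_ne_zero.2 (div_ne_zero (mul_ne_zero (pow_ne_zero 2 hφ)
      (idealAlphaTilde_ne_zero hγ h0)) (mul_ne_zero hγ h0))
  perfect_fluid := fun _ hX => ideal_perfectFluidAt h hX
  φ_deriv := by
    intro τ hτ
    have h0 := h.ne_zero hτ
    have e : deriv (idealT γ I J Q).φ τ = 4 / (3 * γ) * idealPhi γ τ / τ :=
      (hasDerivAt_idealPhi γ h0).deriv
    rw [e]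
    exact div_ne_zero (mul_ne_zero (div_ne_zero four_ne_zero (mul_ne_zero three_ne_zero h.1))
      (idealPhi_pos γ h0).ne') h0
  Q_deriv := h.2.2.2.2.2.2.2.2
  prs_deriv := by
    intro X hX
    have h0 := h.ne_zero hX.1
    -- `IsTModel.uDer_prs` would presuppose the structure under construction, so the derivative is
    -- found from `Reg` and isotropy.
    have e : uDer (idealT γ I J Q).prs X = deriv (idealT γ I J Q).pF (X 0) := by
      rw [uDer_eq, pd_congr 0 (h := fun Z => (idealT γ I J Q).pF (Z 0))
        (Filter.eventually_of_mem ((ideal_reg h).isOpen_domain.mem_nhds hX)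
          fun _ hZ => ideal_prs h hZ)]
      simpa using (HasPd.of_time 0 ((ideal_reg h).hasDerivAt_pF hX.1)).pd_eq
    rw [e, ideal_deriv_pF h hX.1]
    have h1 := h.1
    have h2 := sub_ne_zero.2 h.2.1
    exact div_ne_zero (neg_ne_zero.2 (div_ne_zero (mul_ne_zero (by norm_num) h2) (by positivity)))
      (pow_ne_zero 3 h0)

theorem ideal_sonicConstants :
    (idealT γ I J Q).SonicConstants ((γ - 1) / (2 * γ)) (1 / 2) (1 / (2 * γ)) := by
  rw [(ideal_isTModel h).sonicConstants_iff]
  intro τ hτ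
  have h0 : τ ≠ 0 := h.ne_zero hτ
  have hγ := h.1
  have h1 := sub_ne_zero.2 h.2.1
  have ha : (idealT γ I J Q).aF τ = 9 * γ ^ 3 * τ ^ 4 / (32 * (γ - 1)) := by
    rw [aF, ideal_logD h hτ, ideal_deriv_pF h hτ]
    field_simp
    norm_num
  rw [bF, cF, ha, ideal_pF h hτ, ideal_qF h hτ]
  refine ⟨?_, ?_, ?_⟩ <;> field_simp <;> ring

theorem ideal_rho {X : Pt} (hX : X ∈ (idealT γ I J Q).domain) : (idealT γ I J Q).rho X =
    4 / (3 * γ ^ 2) / X 0 ^ 2 * (1 + idealDelta γ Q (X 0) (X 1)) := by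
  have h0 := h.ne_zero hX.1
  have hγ := h.1
  have hv := ideal_add_ne_zero hX
  have hφ := (Real.sqrt_pos.2 (idealPhi_pos γ h0)).ne'
  have hk : (idealT γ I J Q).k = 0 := rfl
  rw [(ideal_reg h).rho_eq hX, rhoF, ideal_omt h hX.1, ideal_om, ideal_logD h hX.1, hk, idealDelta]
  field_simp
  ring

theorem ideal_chi {X : Pt} (hX : X ∈ (idealT γ I J Q).regular) :
    (idealT γ I J Q).chi X = idealChi γ ((idealT γ I J Q).ratio X) := by
  rw [(ideal_isTModel h).chi_eq_ratio (ideal_sonicConstants h) hX, sq_div_eq_idealChi h.1]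

theorem ideal_ratio {X : Pt} (hX : X ∈ (idealT γ I J Q).domain) :
    (idealT γ I J Q).ratio X = (γ - 1) / (1 + idealDelta γ Q (X 0) (X 1)) := by
  have h0 := h.ne_zero hX.1
  have hγ := h.1
  rw [ratio, ideal_rho h hX, ideal_prs h hX, ideal_pF h hX.1, mul_comm 4 (γ - 1), mul_div_assoc,
    mul_div_assoc, mul_comm (γ - 1)]
  exact mul_div_mul_left _ _ (by positivity)

theorem ideal_energyG_iff {X : Pt} (hX : X ∈ (idealT γ I J Q).domain) :
    (idealT γ I J Q).EnergyG X ↔ 1 < γ ∧ γ - 2 < idealDelta γ Q (X 0) (X 1) := by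
  have h0 := h.ne_zero hX.1
  have hγ := h.1
  have hK : 0 < 4 / (3 * γ ^ 2) / X 0 ^ 2 := by positivity
  rw [EnergyG, ideal_rho h hX, ideal_ratio h hX, mul_pos_iff_of_pos_left hK]
  constructor
  · rintro ⟨h1, h2, h3⟩
    rw [div_lt_one h1] at h3
    -- The sign of `π` is that of `γ - 1` once `1 + δ > 0`; equality is excluded by `γ ≠ 1`.
    have : 0 ≤ γ - 1 := by
      by_contra! hneg
      exact absurd h2 (not_le.2 (div_neg_of_neg_of_pos hneg h1))
    exact ⟨lt_of_le_of_ne (by linarith) (Ne.symm h.2.1), by linarith⟩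
  · rintro ⟨h1, h2⟩
    have h3 : 0 < 1 + idealDelta γ Q (X 0) (X 1) := by linarith
    exact ⟨h3, div_nonneg (by linarith) h3.le, (div_lt_one h3).2 (by linarith)⟩

theorem ideal_regular_compressG {X : Pt} (hX : X ∈ (idealT γ I J Q).domain)
    (hE : (idealT γ I J Q).EnergyG X) : X ∈ (idealT γ I J Q).regular ∧
      CompressG (idealChi γ) ((idealT γ I J Q).ratio X) := by
  have h0 := h.ne_zero hX.1
  have hγ := h.1
  obtain ⟨h1, h2⟩ := (ideal_energyG_iff h hX).1 hE
  have h3 : 0 < 1 + idealDelta γ Q (X 0) (X 1) := by linarith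
  have h4 : 0 < γ - 1 := by linarith
  have hρ := hE.1
  have hp : 0 < (idealT γ I J Q).pF (X 0) := by
    rw [ideal_pF h hX.1]
    positivity
  have hq : 0 < (idealT γ I J Q).qF (X 0) := by
    rw [ideal_qF h hX.1]
    positivity
  refine ⟨(ideal_isTModel h).mem_regular_iff.2 ⟨hX, hρ.ne', (add_pos hρ hp).ne',
    (add_pos hρ hq).ne'⟩, compressG_idealChi h1 ?_ hE.2.2⟩
  rw [ideal_ratio h hX]
  exact div_pos h4 h3

end
end TData

/-! ### Antiderivatives and smooth inverse functions on an interval -/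

theorem exists_smooth_antideriv {g : ℝ → ℝ} {s : Set ℝ} (hs : IsOpen s) (hc : IsConnected s)
    (hg : ContDiffOn ℝ ∞ g s) :
    ∃ R : ℝ → ℝ, ContDiffOn ℝ ∞ R s ∧ ∀ r ∈ s, HasDerivAt R (g r) r := by
  obtain ⟨r₀, hr₀⟩ := hc.nonempty
  have hd : ∀ r ∈ s, HasDerivAt (fun x => ∫ t in r₀..x, g t) (g r) r := by
    intro r hr
    have hsub : uIcc r₀ r ⊆ s := hc.isPreconnected.ordConnected.uIcc_subset hr₀ hr
    exact intervalIntegral.integral_hasDerivAt_right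
      (hg.continuousOn.mono hsub).intervalIntegrable
      (hg.continuousOn.stronglyMeasurableAtFilter hs r hr) (hg.continuousOn.continuousAt (hs.mem_nhds hr))
  refine ⟨_, (contDiffOn_infty_iff_deriv_of_isOpen hs).2 ⟨fun r hr =>
    (hd r hr).differentiableAt.differentiableWithinAt, hg.congr fun r hr => (hd r hr).deriv⟩, hd⟩

/-- By the inverse function theorem there are smooth local inverses; injectivity identifies them
with the global inverse. -/
theorem isOpen_image_and_contDiffOn_invFunOn {R : ℝ → ℝ} {s : Set ℝ} (hs : IsOpen s)
    (hR : ContDiffOn ℝ ∞ R s) (h0 : ∀ r ∈ s, deriv R r ≠ 0) (hinj : InjOn R s) :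
    IsOpen (R '' s) ∧ ContDiffOn ℝ ∞ (Function.invFunOn R s) (R '' s) := by
  have hat := fun r (hr : r ∈ s) => hR.contDiffAt (hs.mem_nhds hr)
  have hd := fun r (hr : r ∈ s) => hR.hasDerivAt_of_isOpen hs hr
  constructor
  · rw [isOpen_iff_mem_nhds]
    rintro _ ⟨r, hr, rfl⟩
    have hst : HasStrictDerivAt R (deriv R r) r := (hat r hr).hasStrictDerivAt (by simp)
    rw [← hst.map_nhds_eq (h0 r hr)]
    exact Filter.image_mem_map (hs.mem_nhds hr)
  · rintro _ ⟨r, hr, rfl⟩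
    have hf := (hd r hr).hasFDerivAt_equiv (h0 r hr)
    have hl := (hat r hr).to_localInverse hf (by simp)
    have hst := (hat r hr).hasStrictFDerivAt' hf (by simp)
    refine (hl.congr_of_eventuallyEq ?_).contDiffWithinAt
    have ht : Filter.Tendsto (hst.localInverse R _ r) (nhds (R r)) (nhds r) := hst.localInverse_tendsto
    filter_upwards [hst.eventually_right_inverse, ht.eventually (hs.mem_nhds hr)] with y hy hys
    have hmem : y ∈ R '' s := ⟨_, hys, hy⟩
    exact hinj (Function.invFunOn_mem hmem) hys ((Function.invFunOn_eq hmem).trans hy.symm)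

theorem exists_const_of_hasDerivAt_zero {s : Set ℝ} (hs : IsOpen s) (hc : IsPreconnected s)
    {f : ℝ → ℝ} (hf : ∀ τ ∈ s, HasDerivAt f 0 τ) : ∃ c, ∀ τ ∈ s, f τ = c :=
  hs.exists_is_const_of_deriv_eq_zero hc
    (fun τ hτ => (hf τ hτ).differentiableAt.differentiableWithinAt) fun τ hτ => (hf τ hτ).deriv

theorem subset_Ioi_or_subset_Iio {s : Set ℝ} (hs : IsPreconnected s) (h0 : (0 : ℝ) ∉ s) :
    s ⊆ Ioi 0 ∨ s ⊆ Iio 0 := by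
  by_contra! h
  obtain ⟨⟨x, hx, hx'⟩, ⟨y, hy, hy'⟩⟩ := And.imp not_subset.1 not_subset.1 h
  exact h0 (hs.ordConnected.out hx hy ⟨not_lt.1 hx', not_lt.1 hy'⟩)

/-! ### Integration of the models with `k = 0`. -/

namespace TData
variable {T : TData}

section
variable (hT : T.IsTModel) (hk : T.k = 0) {γ : ℝ} (hγ : γ ≠ 0)
  (hp : ∀ τ ∈ T.I, T.pF τ = 3 / 4 * (γ - 1) * T.logD τ ^ 2)
include hT hk hγ hp

/-- For `k = 0` the evolution of `b` is `ḃ = -(3γ/4) b²`, so `1/b` is affine in `τ` with slope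
`3γ/4`; `τ₀` is its zero, lying outside `I`. -/
theorem IsTModel.exists_logD_eq :
    ∃ τ₀, ∀ τ ∈ T.I, τ - τ₀ ≠ 0 ∧ T.logD τ = 4 / (3 * γ) / (τ - τ₀) := by
  obtain ⟨c, hc⟩ := exists_const_of_hasDerivAt_zero hT.I_open hT.I_conn.isPreconnected
    (f := fun τ => 1 / T.logD τ - 3 * γ / 4 * τ) fun τ hτ => by
      have hb := hT.logD_ne_zero hτ
      refine (((hasDerivAt_const τ 1).fun_div (hT.reg.hasDerivAt_logD hτ) hb).sub
        ((hasDerivAt_id' τ).const_mul (3 * γ / 4))).congr_deriv ?_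
      rw [hp τ hτ, hk]
      field_simp
      ring
  refine ⟨-(4 * c / (3 * γ)), fun τ hτ => ?_⟩
  have hb := hT.logD_ne_zero hτ
  have e : τ - -(4 * c / (3 * γ)) = 4 / (3 * γ) * (1 / T.logD τ) := by
    rw [← hc τ hτ]
    field_simp
    ring
  rw [e]
  refine ⟨by positivity, ?_⟩
  field_simp

variable {τ₀ : ℝ} (hb : ∀ τ ∈ T.I, τ - τ₀ ≠ 0 ∧ T.logD τ = 4 / (3 * γ) / (τ - τ₀))
include hb

omit hk hp in
theorem IsTModel.exists_φ_eq : ∃ a, 0 < a ∧ ∀ τ ∈ T.I, T.φ τ = a * idealPhi γ (τ - τ₀) := by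
  obtain ⟨a, ha⟩ := exists_const_of_hasDerivAt_zero hT.I_open hT.I_conn.isPreconnected
    (f := fun τ => T.φ τ / idealPhi γ (τ - τ₀)) fun τ hτ => by
      obtain ⟨h0, hl⟩ := hb τ hτ
      have hφ := (idealPhi_pos γ h0).ne'
      have hφ' := (hT.φ_pos τ hτ).ne'
      refine ((hT.reg.hasDerivAt_φ hτ).fun_div
        ((hasDerivAt_idealPhi γ h0).comp_sub_const τ τ₀) hφ).congr_deriv ?_
      rw [logD, div_eq_iff hφ'] at hl
      rw [hl]
      field_simp
      ring
  have ha' : ∀ τ ∈ T.I, T.φ τ = a * idealPhi γ (τ - τ₀) := fun τ hτ => by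
    rw [← ha τ hτ, div_mul_cancel₀ _ (idealPhi_pos γ (hb τ hτ).1).ne']
  refine ⟨a, ?_, ha'⟩
  obtain ⟨τ, hτ⟩ := hT.I_conn.nonempty
  rw [← ha τ hτ]
  exact div_pos (hT.φ_pos τ hτ) (idealPhi_pos γ (hb τ hτ).1)

theorem IsTModel.exists_omega_eq {w : ℝ → ℝ} (hw : ContDiffOn ℝ ∞ w T.I) (hE : T.OmegaEq w) :
    ∃ A B : ℝ, ∀ τ ∈ T.I, w τ = √(idealPhi γ (τ - τ₀)) * (A * idealAlpha γ (τ - τ₀) + B) := by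
  have hY := fun τ (hτ : τ ∈ T.I) =>
    (hasDerivAt_sqrt_idealPhi (γ := γ) (hb τ hτ).1).comp_sub_const τ τ₀
  have hY0 := fun τ (hτ : τ ∈ T.I) => (Real.sqrt_pos.2 (idealPhi_pos γ (hb τ hτ).1)).ne'
  have hα := fun τ (hτ : τ ∈ T.I) => (hasDerivAt_idealAlpha hγ (hb τ hτ).1).comp_sub_const τ τ₀
  have hα' := fun τ (hτ : τ ∈ T.I) =>
    (hasDerivAt_idealAlphaTilde hγ (hb τ hτ).1).comp_sub_const τ τ₀
  have hα0 := fun τ (hτ : τ ∈ T.I) => idealAlphaTilde_ne_zero hγ (hb τ hτ).1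
  have hw1 := fun τ (hτ : τ ∈ T.I) => hw.hasDerivAt_of_isOpen hT.I_open hτ
  have hw2 := fun τ (hτ : τ ∈ T.I) =>
    (hw.deriv_infty hT.I_open).hasDerivAt_of_isOpen hT.I_open hτ
  -- Solving `w = √φ (Aα + B)` and its derivative for `A` and `B` gives two expressions; the Euler
  -- equation makes the first constant, and the second is then constant as well.
  obtain ⟨A, hA⟩ := exists_const_of_hasDerivAt_zero hT.I_open hT.I_conn.isPreconnected
    (f := fun τ => γ * ((τ - τ₀) * deriv w τ - 2 / (3 * γ) * w τ) /
      (√(idealPhi γ (τ - τ₀)) * idealAlphaTilde γ (τ - τ₀))) fun τ hτ => by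
      obtain ⟨h0, hl⟩ := hb τ hτ
      have h1 := hY0 τ hτ
      have h2 := hα0 τ hτ
      refine ((((((hasDerivAt_id' τ).sub_const τ₀).fun_mul (hw2 τ hτ)).fun_sub
        ((hw1 τ hτ).const_mul _)).const_mul γ).fun_div ((hY τ hτ).fun_mul (hα' τ hτ))
        (mul_ne_zero h1 h2)).congr_deriv ?_
      have hdd : deriv (deriv T.φ) τ / T.φ τ = 4 / (3 * γ) * (4 / (3 * γ) - 1) / (τ - τ₀) ^ 2 := by
        have := hp τ hτ
        rw [pF, hk, hl] at this
        have e : deriv (deriv T.φ) τ / T.φ τ = (4 / (3 * γ) / (τ - τ₀)) ^ 2 / 4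
          - 3 / 4 * (γ - 1) * (4 / (3 * γ) / (τ - τ₀)) ^ 2 := by linarith [zero_div (T.φ τ)]
        rw [e]
        field_simp
        ring
      have he := hE τ hτ
      rw [hdd, hl, hk, zero_div, add_zero] at he
      have he' : deriv (deriv w) τ = w τ * (4 / (3 * γ) * (4 / (3 * γ) - 1) / (τ - τ₀) ^ 2 / 2)
        - deriv w τ * (4 / (3 * γ) / (τ - τ₀)) / 2 := by linarith
      rw [he']
      generalize √(idealPhi γ (τ - τ₀)) = Y at h1 ⊢
      generalize idealAlphaTilde γ (τ - τ₀) = α at h2 ⊢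
      generalize τ - τ₀ = t at h0 ⊢
      field_simp
      ring
  obtain ⟨B, hB⟩ := exists_const_of_hasDerivAt_zero hT.I_open hT.I_conn.isPreconnected
    (f := fun τ => w τ / √(idealPhi γ (τ - τ₀)) - A * idealAlpha γ (τ - τ₀)) fun τ hτ => by
      obtain ⟨h0, -⟩ := hb τ hτ
      have h1 := hY0 τ hτ
      have h2 := hα0 τ hτ
      refine (((hw1 τ hτ).fun_div (hY τ hτ) h1).fun_sub ((hα τ hτ).const_mul A)).congr_deriv ?_
      rw [← hA τ hτ]
      field_simp
      ring
  refine ⟨A, B, fun τ hτ => ?_⟩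
  have h1 := hY0 τ hτ
  rw [← hB τ hτ]
  field_simp
  ring

end

/-! ### The normal form by a change of coordinates. -/

theorem pd_coordChange {τ₀ l : ℝ} {R : ℝ → ℝ} {R' : ℝ} {X : Pt} (hR : HasDerivAt R R' (X 1))
    (i a : Fin 4) : pd i (fun Z => coordChange τ₀ l R Z a) X =
      if i = a then (![1, R', l, l] : Fin 4 → ℝ) i else 0 := by
  fin_cases a
  · exact ((HasPd.coord i 0 X).sub (HasPd.const τ₀)).pd_eq.trans (by fin_cases i <;> simp)
  · exact ((HasPd.coord i 1 X).comp hR).pd_eq.trans (by fin_cases i <;> simp)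
  · exact ((HasPd.coord i 2 X).const_mul l).pd_eq.trans (by fin_cases i <;> simp)
  · exact ((HasPd.coord i 3 X).const_mul l).pd_eq.trans (by fin_cases i <;> simp)

theorem pullback_coordChange {τ₀ l : ℝ} {R : ℝ → ℝ} {R' : ℝ} {X : Pt}
    (hR : HasDerivAt R R' (X 1)) (g : MetricField) : pullback (coordChange τ₀ l R) g X =
      fun i j => (![1, R', l, l] : Fin 4 → ℝ) i * (![1, R', l, l] : Fin 4 → ℝ) j *
        g (coordChange τ₀ l R X) i j := by
  funext i j
  simp [pullback, pd_coordChange hR]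

section
variable (hT : T.IsTModel) (hk : T.k = 0) {γ τ₀ a A₁ B₁ A₂ B₂ : ℝ} (hγ : γ ≠ 0) (hγ1 : γ ≠ 1)
  (h0 : ∀ τ ∈ T.I, τ - τ₀ ≠ 0) (ha : 0 < a)
  (hφ : ∀ τ ∈ T.I, T.φ τ = a * idealPhi γ (τ - τ₀))
  (h₁ : ∀ τ ∈ T.I, T.ω₁ τ = √(idealPhi γ (τ - τ₀)) * (A₁ * idealAlpha γ (τ - τ₀) + B₁))
  (h₂ : ∀ τ ∈ T.I, T.ω₂ τ = √(idealPhi γ (τ - τ₀)) * (A₂ * idealAlpha γ (τ - τ₀) + B₂))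
include hT hγ h0 h₁ h₂

/-- The Wronskian of `ω₁` and `ω₂` is this determinant times that of the basis `√φ α`, `√φ`. -/
theorem IsTModel.det_ne_zero : A₁ * B₂ - A₂ * B₁ ≠ 0 := by
  obtain ⟨τ, hτ⟩ := hT.I_conn.nonempty
  intro hD
  have hd : ∀ (w : ℝ → ℝ) (A B : ℝ),
      (∀ τ ∈ T.I, w τ = √(idealPhi γ (τ - τ₀)) * (A * idealAlpha γ (τ - τ₀) + B)) →
      deriv w τ = √(idealPhi γ (τ - τ₀)) * (2 / (3 * γ) * (A * idealAlpha γ (τ - τ₀) + B)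
        + A * idealAlphaTilde γ (τ - τ₀) / γ) / (τ - τ₀) := by
    intro w A B hw
    exact (((hasDerivAt_sqrt_mul A B hγ (h0 τ hτ)).comp_sub_const τ τ₀).congr_of_eventuallyEq
      (Filter.eventually_of_mem (hT.I_open.mem_nhds hτ) hw)).deriv
  refine hT.wronskian τ hτ ?_
  rw [hd _ _ _ h₁, hd _ _ _ h₂, h₁ τ hτ, h₂ τ hτ]
  have := h0 τ hτ
  field_simp
  linear_combination
    -3 * √(idealPhi γ (τ - τ₀)) ^ 2 * idealAlphaTilde γ (τ - τ₀) * hD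

theorem IsTModel.exceptional_subsingleton : {r ∈ T.J | A₁ + A₂ * T.Q r = 0}.Subsingleton := by
  rintro r ⟨hr, h1⟩ s ⟨hs, h2⟩
  refine hT.injOn_Q hr hs ?_
  have h3 : A₂ * (T.Q r - T.Q s) = 0 := by linear_combination h1 - h2
  rcases mul_eq_zero.1 h3 with h | h
  · have : A₁ = 0 := by simpa [h] using h1
    exact absurd (by simp [h, this]) (hT.det_ne_zero hγ h0 h₁ h₂)
  · linarith

include hk hγ1 ha hφ

/-- Here `ω = √(idealPhi) ((A₁ + A₂Q) α + B₁ + B₂Q)`. The factor `A₁ + A₂Q` is absorbed into `dr` by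
choosing `R' = A₁ + A₂Q`, and the factor `a` of `φ` by rescaling `x`, `y` with `√a`. -/
theorem IsTModel.exists_isometry {J' : Set ℝ} (hJ : J' ⊆ T.J \ {r ∈ T.J | A₁ + A₂ * T.Q r = 0})
    (hJo : IsOpen J') (hJc : IsConnected J') :
    ∃ R Q : ℝ → ℝ, ContDiffOn ℝ ∞ R J' ∧ (∀ r ∈ J', deriv R r ≠ 0) ∧
      IdealAdmissible γ ((fun τ => τ - τ₀) '' T.I) (R '' J') Q ∧
      Set.BijOn (coordChange τ₀ (√a) R) {X ∈ T.domain | X 1 ∈ J'}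
        (idealT γ ((fun τ => τ - τ₀) '' T.I) (R '' J') Q).domain ∧
      ∀ X ∈ T.domain, X 1 ∈ J' → T.metric X = pullback (coordChange τ₀ (√a) R)
        (idealT γ ((fun τ => τ - τ₀) '' T.I) (R '' J') Q).metric X := by
  have hJJ : J' ⊆ T.J := fun r hr => (hJ hr).1
  have hg0 : ∀ r ∈ J', A₁ + A₂ * T.Q r ≠ 0 := fun r hr h => (hJ hr).2 ⟨hJJ hr, h⟩
  have hQ : ContDiffOn ℝ ∞ T.Q J' := hT.Q_smooth.mono hJJ
  have hg : ContDiffOn ℝ ∞ (fun r => A₁ + A₂ * T.Q r) J' :=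
    contDiffOn_const.add (contDiffOn_const.mul hQ)
  have hM : ContDiffOn ℝ ∞ (fun r => (B₁ + B₂ * T.Q r) / (A₁ + A₂ * T.Q r)) J' :=
    (contDiffOn_const.add (contDiffOn_const.mul hQ)).div hg hg0
  obtain ⟨R, hR, hRd⟩ := exists_smooth_antideriv hJo hJc hg
  have hR0 : ∀ r ∈ J', deriv R r ≠ 0 := fun r hr => by
    rw [(hRd r hr).deriv]
    exact hg0 r hr
  have hinj : InjOn R J' := injOn_of_deriv_ne_zero hJc.isPreconnected
    (fun r hr => (hRd r hr).differentiableAt) hR0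
  obtain ⟨hRo, hS⟩ := isOpen_image_and_contDiffOn_invFunOn hJo hR hR0 hinj
  have hSR : ∀ r ∈ J', Function.invFunOn R J' (R r) = r :=
    fun r hr => hinj.leftInvOn_invFunOn hr
  set Q : ℝ → ℝ := (fun r => (B₁ + B₂ * T.Q r) / (A₁ + A₂ * T.Q r)) ∘ Function.invFunOn R J'
    with hQdef
  have hQR : ∀ r ∈ J', Q (R r) = (B₁ + B₂ * T.Q r) / (A₁ + A₂ * T.Q r) := fun r hr => by
    simp only [hQdef, Function.comp_apply, hSR r hr]
  have hQs : ContDiffOn ℝ ∞ Q (R '' J') := hM.comp hS fun y hy => Function.invFunOn_mem hy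
  have hadm : IdealAdmissible γ ((fun τ => τ - τ₀) '' T.I) (R '' J') Q := by
    refine ⟨hγ, hγ1, (Homeomorph.subRight τ₀).isOpenMap _ hT.I_open,
      hT.I_conn.image _ (by fun_prop), hRo, hJc.image _ hR.continuousOn, ?_, hQs, ?_⟩
    · refine subset_Ioi_or_subset_Iio (hT.I_conn.image _ (by fun_prop)).isPreconnected ?_
      rintro ⟨τ, hτ, h⟩
      exact h0 τ hτ h
    · rintro _ ⟨r, hr, rfl⟩ hzero
      have hd := hQs.hasDerivAt_of_isOpen hRo (mem_image_of_mem R hr)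
      rw [hzero] at hd
      have hQ' := hT.Q_smooth.hasDerivAt_of_isOpen hT.J_open (hJJ hr)
      have hd1 := (hd.comp r (hRd r hr)).congr_of_eventuallyEq
        (f₁ := fun r => (B₁ + B₂ * T.Q r) / (A₁ + A₂ * T.Q r))
        (Filter.eventually_of_mem (hJo.mem_nhds hr) fun s hs => (hQR s hs).symm)
      have hd2 := hd1.unique (((hQ'.const_mul B₂).const_add B₁).fun_div
        ((hQ'.const_mul A₂).const_add A₁) (hg0 r hr))
      rw [zero_mul, eq_comm, div_eq_zero_iff] at hd2
      -- The numerator of the derivative of the quotient is `Q' (A₁B₂ - A₂B₁)`.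
      rcases hd2 with h | h
      · refine mul_ne_zero (hT.Q_deriv r (hJJ hr)) (hT.det_ne_zero hγ h0 h₁ h₂) ?_
        linear_combination h
      · exact pow_ne_zero 2 (hg0 r hr) h
  have hom : ∀ τ ∈ T.I, ∀ r ∈ J', T.om τ r = (A₁ + A₂ * T.Q r) *
      (√(idealPhi γ (τ - τ₀)) * (idealAlpha γ (τ - τ₀) + Q (R r))) := by
    intro τ hτ r hr
    have := hg0 r hr
    rw [om, h₁ τ hτ, h₂ τ hτ, hQR r hr]
    field_simp
    ring
  have hl : 0 < √a := Real.sqrt_pos.2 ha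
  refine ⟨R, Q, hR, hR0, hadm, ⟨?_, ?_, ?_⟩, ?_⟩
  · rintro X ⟨⟨hI, -, ho, -⟩, h1⟩
    refine ⟨⟨X 0, hI, rfl⟩, ⟨X 1, h1, rfl⟩, ?_, by simp [idealT]⟩
    rw [hom _ hI _ h1] at ho
    rw [ideal_om]
    exact (mul_ne_zero_iff.1 ho).2
  · rintro X ⟨-, h1⟩ Z ⟨-, h2⟩ h
    have e := fun i => congrFun h i
    have e0 := e 0
    have e1 := e 1
    have e2 := e 2
    have e3 := e 3
    simp [coordChange, hl.ne'] at e0 e1 e2 e3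
    funext i
    fin_cases i
    · exact e0
    · exact hinj h1 h2 e1
    · exact e2
    · exact e3
  · rintro X ⟨⟨τ, hI, h1⟩, ⟨r, hr, h2⟩, ho, -⟩
    rw [ideal_om, ← h1, ← h2] at ho
    refine ⟨![τ, r, X 2 / √a, X 3 / √a], ⟨⟨hI, hJJ hr, ?_, by simp [hk]⟩, hr⟩, ?_⟩
    · exact (hom τ hI r hr).trans_ne (mul_ne_zero (hg0 r hr) ho)
    · funext i
      fin_cases i
      · exact h1
      · exact h2
      · exact mul_div_cancel₀ _ hl.ne'
      · exact mul_div_cancel₀ _ hl.ne'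
  · intro X hX h1
    rw [pullback_coordChange (hRd _ h1)]
    funext i j
    by_cases hij : i = j
    · subst hij
      simp only [metric, Matrix.diagonal_apply_eq, ideal_om]
      fin_cases i
      · simp
      · simp [coordChange, hom _ hX.1 _ h1]
        ring
      · simp [coordChange, conf, hk, hφ _ hX.1, idealT, Real.mul_self_sqrt ha.le]
      · simp [coordChange, conf, hk, hφ _ hX.1, idealT, Real.mul_self_sqrt ha.le]
    · simp [metric, Matrix.diagonal_apply_ne _ hij]

end
end TData

end

/-! ### Assembly of the theorem. -/

theorem mainTheorem5 :
    -- the ideal sonic condition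
    (∀ T : TData, T.IsTModel → (T.IdealSonic ↔ T.CaseI ∨ T.CaseII)) ∧
    -- the sign of the pressure in case (ii)
    (∀ (T : TData) (c₀ : ℝ), T.IsTModel → T.k ≠ 0 →
      (∀ τ ∈ T.I, deriv T.φ τ ^ 2 = c₀ ^ 2 * T.φ τ) →
      ∀ X ∈ T.domain, (T.prs X < 0 ↔ 0 < c₀ ^ 2 + 4 * T.k)) ∧
    -- every model of case (i) has the indicatrix and the metric of an ideal T-model
    (∀ (T : TData) (c₁ c₂ c₃ : ℝ), T.IsTModel → T.k = 0 → T.SonicConstants c₁ c₂ c₃ →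
      c₂ = c₁ + c₃ → c₁ + c₃ = 1 / 2 →
      ∃ γ : ℝ, γ ≠ 0 ∧ γ ≠ 1 ∧ c₁ = (γ - 1) / (2 * γ) ∧ c₃ = 1 / (2 * γ) ∧
        (∀ X ∈ T.regular, T.chi X = idealChi γ (T.ratio X)) ∧
        ∃ τ₀ l : ℝ, 0 < l ∧ ∃ E : Set ℝ, E.Subsingleton ∧
          ∀ J' : Set ℝ, J' ⊆ T.J \ E → IsOpen J' → IsConnected J' →
            ∃ R Q : ℝ → ℝ, ContDiffOn ℝ ∞ R J' ∧ (∀ r ∈ J', deriv R r ≠ 0) ∧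
              IdealAdmissible γ ((fun τ => τ - τ₀) '' T.I) (R '' J') Q ∧
              Set.BijOn (coordChange τ₀ l R) {X ∈ T.domain | X 1 ∈ J'}
                (idealT γ ((fun τ => τ - τ₀) '' T.I) (R '' J') Q).domain ∧
              ∀ X ∈ T.domain, X 1 ∈ J' →
                T.metric X = pullback (coordChange τ₀ l R)
                  (idealT γ ((fun τ => τ - τ₀) '' T.I) (R '' J') Q).metric X) ∧
    -- conversely, every ideal T-model is a T-model of case (i); its physical conditions
    (∀ (γ : ℝ) (I J : Set ℝ) (Q : ℝ → ℝ), IdealAdmissible γ I J Q →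
      (idealT γ I J Q).IsTModel ∧
      (idealT γ I J Q).SonicConstants ((γ - 1) / (2 * γ)) (1 / 2) (1 / (2 * γ)) ∧
      (∀ X ∈ (idealT γ I J Q).regular,
        (idealT γ I J Q).chi X = idealChi γ ((idealT γ I J Q).ratio X)) ∧
      ∀ X ∈ (idealT γ I J Q).domain,
        ((idealT γ I J Q).EnergyG X ↔ 1 < γ ∧ γ - 2 < idealDelta γ Q (X 0) (X 1)) ∧
        ((idealT γ I J Q).EnergyG X → X ∈ (idealT γ I J Q).regular ∧
          CompressG (idealChi γ) ((idealT γ I J Q).ratio X))) := by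
  refine ⟨fun T hT => hT.idealSonic_iff, fun T c₀ hT _ h0 X hX => hT.prs_neg_iff h0 hX, ?_,
    fun γ I J Q h => ⟨TData.ideal_isTModel h, TData.ideal_sonicConstants h,
      fun X hX => TData.ideal_chi h hX, fun X hX => ⟨TData.ideal_energyG_iff h hX,
        TData.ideal_regular_compressG h hX⟩⟩⟩
  intro T c₁ c₂ c₃ hT hk hc h2 h12
  have hc₁ := hT.c₁_ne_zero hc
  have hc₃ := (hT.c₁_add_c₃ hc hk).1
  -- The parameter `γ` is `1/(2c₃)`; the value of `c₁` then follows from `c₁ + c₃ = 1/2`, and `c₁ ≠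
  -- 0` excludes `γ = 1`.
  have e1 : c₁ = (1 / (2 * c₃) - 1) / (2 * (1 / (2 * c₃))) := by
    field_simp
    linear_combination 2 * h12
  have e3 : c₃ = 1 / (2 * (1 / (2 * c₃))) := by field_simp
  have hγ : 1 / (2 * c₃) ≠ 0 := by positivity
  generalize 1 / (2 * c₃) = γ at e1 e3 hγ
  have hγ1 : γ ≠ 1 := by
    rintro rfl
    exact hc₁ (by rw [e1]; norm_num)
  refine ⟨γ, hγ, hγ1, e1, e3, fun X hX => ?_, ?_⟩
  · rw [hT.chi_eq_ratio hc hX, h2, h12, ← sq_div_eq_idealChi hγ, ← e1, ← e3]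
  -- The relation `c₁ q = c₃ p` now says `p = (γ - 1) q`, with `q = (3/4) b²`.
  have hp : ∀ τ ∈ T.I, T.pF τ = 3 / 4 * (γ - 1) * T.logD τ ^ 2 := by
    intro τ hτ
    have h := hT.c₁_mul_qF hc hτ
    rw [e1, e3, TData.qF, hk] at h
    field_simp at h
    linear_combination -h / 4
  obtain ⟨τ₀, hb⟩ := hT.exists_logD_eq hk hγ hp
  obtain ⟨a, ha, hφ⟩ := hT.exists_φ_eq hγ hb
  obtain ⟨A₁, B₁, h₁⟩ := hT.exists_omega_eq hk hγ hp hb hT.ω₁_smooth hT.omegaEq.1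
  obtain ⟨A₂, B₂, h₂⟩ := hT.exists_omega_eq hk hγ hp hb hT.ω₂_smooth hT.omegaEq.2
  have h0 := fun τ hτ => (hb τ hτ).1
  exact ⟨τ₀, √a, Real.sqrt_pos.2 ha, _, hT.exceptional_subsingleton hγ h0 h₁ h₂,
    fun J' hJ hJo hJc => hT.exists_isometry hk hγ hγ1 h0 ha hφ h₁ h₂ hJ hJo hJc⟩
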